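/- Let $G$ be a finite abelian group of order $n$ with dual group $\hat G$ (written additively), and let $S$ be the set of bijections $\{1,\dots,n\}\to G$. For $\chi=(\chi_1,\dots,\chi_n)\in\hat G^n$ put $$\hat{1_S}(\chi)=\frac1{n^n}\sum_{x_1,\dots,x_n}\chi_1(x_1)\cdots\chi_n(x_n),$$ where the sum runs over all $(x_1,\dots,x_n)\in G^n$ with distinct coordinates. Call $\chi$ *$m$-sparse* if exactly $m$ of its coordinates $\chi_i$ are nonzero (that is, nontrivial characters). (i) There is an absolute constant $C>0$ such that for all such $G$ and $n$, every real $\delta$ with $0\le\delta\le 1/2$ and every integer $m$ with $0\le m\le n/2$, $$\sum_{m\text{-sparse }\chi}|\hat{1_S}(\chi)|^3\le e^{C(m^{3/2}/n^{1/2}+m^{1/2})}(1-\delta)^{m/2}\Big(\frac{n!}{n^n}\Big)^3+2^m n^{\delta m+1}\binom nm^{-1/2}\Big(\frac{n!}{n^n}\Big)^3.$$ (ii) There are absolute constants $0<\eta<1$, $M_0\in\mathbb N$, $K>0$ and $c>0$ such that for all such $G$ with $n\ge2$ and every integer $M\ge M_0$, $$\sum_{M\le m\le n/(\log n)^2}\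 \sum_{m\text{-sparse }\chi}|\hat{1_S}(\chi)|^3\le K\,\eta^M\Big(\frac{n!}{n^n}\Big)^3+K\,e^{-cn^{1/2}}\Big(\frac{n!}{n^n}\Big)^3.$$ -/

import Mathlib

/-- The set `S` of all bijections `{1, …, n} → G`, where `n = |G|`. -/
def bijectionSet (G : Type*) [Fintype G] : Set (Fin (Fintype.card G) → G) :=
  {π | Function.Bijective π}

/-- The Fourier transform on the finite abelian group `G ^ ι`, whose characters are the families
`χ = (χ_i)` of characters of `G`, for the uniform probability measure on `G ^ ι` (and with no
complex conjugation): `F ↦ |G| ^ (-|ι|) ∑_x F(x) ∏_i χ_i(x_i)`. -/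
noncomputable def fourierTransform {G ι : Type*} [AddCommGroup G] [Fintype G] [Fintype ι]
    [DecidableEq ι] (F : (ι → G) → ℂ) (χ : ι → AddChar G ℂ) : ℂ :=
  (1 / (Fintype.card G : ℂ) ^ Fintype.card ι) * ∑ x : ι → G, F x * ∏ i, χ i (x i)

/-- The Fourier transform of the indicator function of the set of bijections `{1, …, n} → G`. -/
noncomputable def hatS (G : Type*) [AddCommGroup G] [Fintype G]
    (χ : Fin (Fintype.card G) → AddChar G ℂ) : ℂ :=
  fourierTransform ((bijectionSet G).indicator fun _ => (1 : ℂ)) χ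

/-- `χ` is `m`-sparse if exactly `m` of its coordinates are nonzero, where `0` is the trivial
character, the neutral element of the (additively written) dual group. -/
def IsSparse {G ι : Type*} [AddCommGroup G] (m : ℕ) (χ : ι → AddChar G ℂ) : Prop :=
  {i | χ i ≠ 0}.ncard = m

open scoped Classical in
/-- The sum of `|hatS(χ)|³` over all `m`-sparse `χ`. -/
noncomputable def sparseCubeSum (G : Type*) [AddCommGroup G] [Fintype G] (m : ℕ) : ℝ :=
  ∑ χ : Fin (Fintype.card G) → AddChar G ℂ with IsSparse m χ, ‖hatS G χ‖ ^ 3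

universe u

/-! Up to the factor $n!/n^n$, $\hat{1_S}(\chi)$ is the mean $b(\chi)$ of $\prod_i\chi_i(\pi(i))$
over bijections $\pi$ (`bijMean`). If $\chi_i\ne0$, moving $\chi_i$ to every index $j$ in turn and
summing gives $0$, because $\sum_x\chi_i(x)=0$. For $j=i$ or $\chi_j=0$ the mean is unchanged by
symmetry, so an $m$-sparse $\chi$ satisfies $(n-m+1)|b(\chi)|\le\sum_j|b(\chi^{(j)})|$, where $j$
runs over the other $m-1$ support indices and $\chi_i$ is merged into $\chi_j$. A merge lowers the
sparsity by 2 if $\chi_i+\chi_j=0$ and by 1 otherwise (`norm_bijMean_le_sum_moveChar`).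

Induction gives $|b(\chi)|\le\binom nm^{-1/2}$ (`norm_bijMean_le`). Only cancelling merges
contribute to the main order. Unless one character of order 2 fills more than about a proportion
$p=1-\delta$ of the support, $i$ can be chosen with at most about $pm$ cancelling partners. Each
such step then gains a factor $p$ for two coordinates removed, hence $p^{m/2}$ overall, up to a
subexponential loss (`norm_bijMean_le_of_card_charFiber_le`).

Orthogonality evaluates $\sum|b|^2$ over characters supported in a given set. Differencing gives the
mass on an exact support, and its three-term recurrence bounds that mass by $\binom nm^{-1/2}$ up to
the same loss (`exactMass_le`).

For the cubes, characters without a dominant value are treated by supremum times $L^2$ mass, and the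
dominated ones by counting times the square-root bound cubed (`sum_norm_bijMean_cube_le`). Part (ii)
optimises $\delta$ and sums over $m$. -/

set_option linter.unusedSectionVars false

/-! ### Means over bijections and the merging inequality. -/

section Mean

variable {G ι : Type*} [AddCommGroup G] [Fintype G] [DecidableEq G] [Fintype ι] [DecidableEq ι]

/-- The mean of `∏ i, χ i (π i)` over all bijections `π : ι ≃ G`. -/
noncomputable def bijMean (χ : ι → AddChar G ℂ) : ℂ :=
  (((Fintype.card G).factorial : ℂ))⁻¹ * ∑ π : ι ≃ G, ∏ i, χ i (π i)

/-- The set of indices at which `χ` is nontrivial. -/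
noncomputable def charSupport (χ : ι → AddChar G ℂ) : Finset ι := {i | χ i ≠ 0}

/-- The set of indices at which `χ` takes the value `ψ`. -/
noncomputable def charFiber (χ : ι → AddChar G ℂ) (ψ : AddChar G ℂ) : Finset ι := {i | χ i = ψ}

/-- Move the character at `i` onto the index `j`. -/
def moveChar (χ : ι → AddChar G ℂ) (i j : ι) : ι → AddChar G ℂ :=
  Function.update χ i 0 + Pi.single j (χ i)

@[simp] lemma mem_charSupport {χ : ι → AddChar G ℂ} {i : ι} : i ∈ charSupport χ ↔ χ i ≠ 0 := by
  simp [charSupport]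

@[simp] lemma mem_charFiber {χ : ι → AddChar G ℂ} {ψ : AddChar G ℂ} {i : ι} :
    i ∈ charFiber χ ψ ↔ χ i = ψ := by
  simp [charFiber]

lemma moveChar_apply_self {χ : ι → AddChar G ℂ} {i j : ι} (h : j ≠ i) : moveChar χ i j i = 0 := by
  simp [moveChar, h.symm]

lemma moveChar_apply_target {χ : ι → AddChar G ℂ} {i j : ι} (h : j ≠ i) :
    moveChar χ i j j = χ j + χ i := by
  simp [moveChar, h]

lemma moveChar_apply_of_ne {χ : ι → AddChar G ℂ} {i j l : ι} (h : l ≠ i) (h' : l ≠ j) :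
    moveChar χ i j l = χ l := by
  simp [moveChar, h, h']

lemma bijMean_comp (χ : ι → AddChar G ℂ) (e : Equiv.Perm ι) :
    bijMean (fun i => χ (e i)) = bijMean χ := by
  unfold bijMean
  congr 1
  refine Fintype.sum_equiv (e.equivCongr (Equiv.refl G)) _ _ fun π => ?_
  refine Fintype.prod_equiv e _ _ fun i => ?_
  simp [Equiv.equivCongr]

lemma norm_bijMean_le_one (hc : Fintype.card ι = Fintype.card G) (χ : ι → AddChar G ℂ) :
    ‖bijMean χ‖ ≤ 1 := by
  have h : ‖∑ π : ι ≃ G, ∏ i, χ i (π i)‖ ≤ (Fintype.card G).factorial := by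
    refine (norm_sum_le _ _).trans ?_
    simp [norm_prod, Fintype.card_equiv (Fintype.equivOfCardEq hc), hc]
  unfold bijMean
  rw [norm_mul, norm_inv, Complex.norm_natCast]
  exact inv_mul_le_one_of_le₀ h (by positivity)

/-- For fixed $\pi$ the moved character contributes the factor $\chi_i(\pi(j))$. As $\pi$ is a
bijection, summing over $j$ is summing a nontrivial character over all of $G$. -/
lemma sum_bijMean_moveChar {χ : ι → AddChar G ℂ} {i : ι} (hi : χ i ≠ 0) :
    ∑ j, bijMean (moveChar χ i j) = 0 := by
  unfold bijMean
  rw [← Finset.mul_sum, Finset.sum_comm]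
  refine mul_eq_zero_of_right _ (Finset.sum_eq_zero fun π _ => ?_)
  have h : ∀ j, ∏ l, moveChar χ i j l (π l) =
      (∏ l, Function.update χ i 0 l (π l)) * χ i (π j) := fun j => by
    have : ∏ l, (Pi.single j (χ i) : ι → AddChar G ℂ) l (π l) = χ i (π j) := by
      rw [Fintype.prod_eq_single j]
      · simp
      · intro l hl; simp [hl]
    rw [← this, ← Finset.prod_mul_distrib]
    simp [moveChar]
  simp_rw [h]
  rw [← Finset.mul_sum, Equiv.sum_comp π (fun x => χ i x), AddChar.sum_eq_zero_iff_ne_zero.2 hi,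
    mul_zero]

/-- Moving a character onto an empty index is a transposition of coordinates, and the mean is
invariant under those. -/
lemma bijMean_moveChar_of_notMem {χ : ι → AddChar G ℂ} {i j : ι}
    (hj : j ∉ (charSupport χ).erase i) : bijMean (moveChar χ i j) = bijMean χ := by
  by_cases hji : j = i
  · subst hji
    congr 1
    ext l : 1
    by_cases hl : l = j
    · subst hl; simp [moveChar]
    · exact moveChar_apply_of_ne hl hl
  have h0 : χ j = 0 := by simpa [hji] using hj
  rw [← bijMean_comp χ (Equiv.swap i j)]
  congr 1
  ext l : 1
  by_cases hl : l = i
  · subst hl; rw [moveChar_apply_self hji, Equiv.swap_apply_left, h0]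
  by_cases hl' : l = j
  · subst hl'; rw [moveChar_apply_target hji, Equiv.swap_apply_right, h0, zero_add]
  · rw [moveChar_apply_of_ne hl hl', Equiv.swap_apply_of_ne_of_ne hl hl']

/-- Summing over the position of a nontrivial character merges it with the other nontrivial ones. -/
lemma norm_bijMean_le_sum_moveChar (hc : Fintype.card ι = Fintype.card G)
    {χ : ι → AddChar G ℂ} {i : ι} (hi : i ∈ charSupport χ) :
    ((Fintype.card G : ℝ) - (charSupport χ).card + 1) * ‖bijMean χ‖ ≤
      ∑ j ∈ (charSupport χ).erase i, ‖bijMean (moveChar χ i j)‖ := by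
  have h := sum_bijMean_moveChar (mem_charSupport.1 hi)
  rw [← Finset.sum_add_sum_compl ((charSupport χ).erase i),
    Finset.sum_congr (s₁ := ((charSupport χ).erase i)ᶜ) rfl
      (fun j hj => bijMean_moveChar_of_notMem (Finset.mem_compl.1 hj)),
    Finset.sum_const, nsmul_eq_mul] at h
  have hcard : ((((charSupport χ).erase i)ᶜ).card : ℝ) =
      (Fintype.card G : ℝ) - (charSupport χ).card + 1 := by
    have h1 := Finset.card_add_card_compl ((charSupport χ).erase i)
    have h2 := Finset.card_erase_add_one hi
    rw [hc] at h1
    have h1' : (((charSupport χ).erase i).card : ℝ) + (((charSupport χ).erase i)ᶜ).card =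
      Fintype.card G := by exact_mod_cast h1
    have h2' : (((charSupport χ).erase i).card : ℝ) + 1 = (charSupport χ).card := by
      exact_mod_cast h2
    linarith
  rw [← hcard, ← Complex.norm_natCast, ← norm_mul, ← neg_eq_of_add_eq_zero_right h, norm_neg]
  exact norm_sum_le _ _

lemma charSupport_moveChar_of_add_eq_zero {χ : ι → AddChar G ℂ} {i j : ι} (hji : j ≠ i)
    (h : χ j + χ i = 0) : charSupport (moveChar χ i j) = ((charSupport χ).erase i).erase j := by
  ext l
  by_cases hl : l = i
  · subst hl; simp [moveChar_apply_self hji]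
  by_cases hl' : l = j
  · subst hl'; simp [moveChar_apply_target hji, h]
  · simp [moveChar_apply_of_ne hl hl', hl, hl']

lemma charSupport_moveChar_of_add_ne_zero {χ : ι → AddChar G ℂ} {i j : ι} (hji : j ≠ i)
    (hj : χ j ≠ 0) (h : χ j + χ i ≠ 0) :
    charSupport (moveChar χ i j) = (charSupport χ).erase i := by
  ext l
  by_cases hl : l = i
  · subst hl; simp [moveChar_apply_self hji]
  by_cases hl' : l = j
  · subst hl'; simp [moveChar_apply_target hji, h, hj, hl]
  · simp [moveChar_apply_of_ne hl hl', hl]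

lemma charFiber_moveChar_of_add_eq_zero {χ : ι → AddChar G ℂ} {i j : ι} (hji : j ≠ i)
    (h : χ j + χ i = 0) {ψ : AddChar G ℂ} (hψ : ψ ≠ 0) :
    charFiber (moveChar χ i j) ψ = ((charFiber χ ψ).erase i).erase j := by
  ext l
  by_cases hl : l = i
  · subst hl; simp [moveChar_apply_self hji, hψ.symm]
  by_cases hl' : l = j
  · subst hl'; simp [moveChar_apply_target hji, h, hψ.symm]
  · simp [moveChar_apply_of_ne hl hl', hl, hl']

lemma charFiber_moveChar_subset {χ : ι → AddChar G ℂ} {i j : ι} (hji : j ≠ i)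
    {ψ : AddChar G ℂ} (hψ : ψ ≠ 0) :
    charFiber (moveChar χ i j) ψ ⊆ insert j (charFiber χ ψ) := by
  intro l
  by_cases hl : l = i
  · subst hl; simp [moveChar_apply_self hji, hψ.symm]
  by_cases hl' : l = j
  · subst hl'; simp
  · simpa [moveChar_apply_of_ne hl hl'] using Or.inr

lemma charFiber_subset_charSupport {χ : ι → AddChar G ℂ} {ψ : AddChar G ℂ} (hψ : ψ ≠ 0) :
    charFiber χ ψ ⊆ charSupport χ := by
  intro i hi
  rw [mem_charFiber] at hi
  simpa [hi] using hψ

lemma card_charFiber_add_card_charFiber_le {χ : ι → AddChar G ℂ} {ψ φ : AddChar G ℂ}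
    (hψ : ψ ≠ 0) (hφ : φ ≠ 0) (h : ψ ≠ φ) :
    (charFiber χ ψ).card + (charFiber χ φ).card ≤ (charSupport χ).card := by
  rw [← Finset.card_union_of_disjoint]
  · exact Finset.card_le_card
      (Finset.union_subset (charFiber_subset_charSupport hψ) (charFiber_subset_charSupport hφ))
  · rw [Finset.disjoint_left]
    intro i hi hi'
    exact h ((mem_charFiber.1 hi).symm.trans (mem_charFiber.1 hi'))

end Mean

/-! ### Reduction of the Fourier coefficients to means over bijections. -/

section Hat

variable {G : Type*} [AddCommGroup G] [Fintype G] [DecidableEq G]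

lemma hatS_eq_bijMean (χ : Fin (Fintype.card G) → AddChar G ℂ) :
    hatS G χ = (((Fintype.card G).factorial : ℂ) / (Fintype.card G : ℂ) ^ Fintype.card G) *
      bijMean χ := by
  have h0 : ((Fintype.card G).factorial : ℂ) ≠ 0 := by exact_mod_cast Nat.factorial_ne_zero _
  have hsum : ∑ x : Fin (Fintype.card G) → G,
      ((bijectionSet G).indicator (fun _ => (1 : ℂ)) x * ∏ i, χ i (x i)) =
      ∑ π : Fin (Fintype.card G) ≃ G, ∏ i, χ i (π i) := by
    classical
    rw [← Finset.sum_filter_add_sum_filter_not _ (fun x => Function.Bijective x)]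
    rw [Finset.sum_eq_zero (s := Finset.univ.filter fun x : Fin (Fintype.card G) → G =>
      ¬ Function.Bijective x), add_zero]
    · symm
      refine Finset.sum_bij (fun π _ => (π : Fin (Fintype.card G) → G)) ?_ ?_ ?_ ?_
      · intro π _; exact Finset.mem_filter.2 ⟨Finset.mem_univ _, π.bijective⟩
      · intro π _ σ _ h; exact DFunLike.coe_injective h
      · intro x hx
        exact ⟨Equiv.ofBijective x (Finset.mem_filter.1 hx).2, Finset.mem_univ _, rfl⟩
      · intro π _
        rw [Set.indicator_of_mem (show (π : _ → G) ∈ bijectionSet G from π.bijective), one_mul]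
    · intro x hx
      rw [Set.indicator_of_notMem (show x ∉ bijectionSet G from (Finset.mem_filter.1 hx).2), zero_mul]
  unfold hatS fourierTransform bijMean
  rw [hsum, Fintype.card_fin]
  field_simp

lemma isSparse_iff_card_charSupport {m : ℕ} {χ : Fin (Fintype.card G) → AddChar G ℂ} :
    IsSparse m χ ↔ (charSupport χ).card = m := by
  unfold IsSparse charSupport
  rw [← Set.ncard_coe_finset]
  simp

lemma sparseCubeSum_eq (m : ℕ) :
    sparseCubeSum G m =
      (∑ χ : Fin (Fintype.card G) → AddChar G ℂ with (charSupport χ).card = m, ‖bijMean χ‖ ^ 3) *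
      (((Fintype.card G).factorial : ℝ) / (Fintype.card G : ℝ) ^ Fintype.card G) ^ 3 := by
  unfold sparseCubeSum
  simp_rw [isSparse_iff_card_charSupport]
  rw [Finset.sum_mul]
  refine Finset.sum_congr (Finset.filter_congr_decidable _ _ _) fun χ _ => ?_
  rw [hatS_eq_bijMean, norm_mul, mul_pow, mul_comm]
  simp

end Hat

/-! ### Numerical inequalities driving the inductions. -/

section Numeric

/-- The quantity `(n.choose m) ^ (-1/2)`. -/
noncomputable def invSqrtChoose (n m : ℕ) : ℝ := (√(n.choose m : ℝ))⁻¹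

/-- The subexponential loss factor `exp (O(m ^ (1/2) + m ^ (3/2) / n ^ (1/2)))`. -/
noncomputable def lossFactor (n m : ℕ) : ℝ :=
  Real.exp (4 * √(m : ℝ) + 17 * (m * √((m : ℝ) / n)))

lemma lossFactor_pos (n m : ℕ) : 0 < lossFactor n m := Real.exp_pos _

lemma one_le_lossFactor (n m : ℕ) : 1 ≤ lossFactor n m := Real.one_le_exp (by positivity)

lemma invSqrtChoose_nonneg (n m : ℕ) : 0 ≤ invSqrtChoose n m := by
  unfold invSqrtChoose; positivity

lemma invSqrtChoose_pos {n m : ℕ} (h : m ≤ n) : 0 < invSqrtChoose n m := by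
  have : (0 : ℝ) < n.choose m := by exact_mod_cast Nat.choose_pos h
  unfold invSqrtChoose; positivity

lemma invSqrtChoose_sq (n m : ℕ) : invSqrtChoose n m ^ 2 = ((n.choose m : ℝ))⁻¹ := by
  rw [invSqrtChoose, inv_pow, Real.sq_sqrt (by positivity)]

@[simp] lemma invSqrtChoose_zero (n : ℕ) : invSqrtChoose n 0 = 1 := by simp [invSqrtChoose]

lemma choose_succ_mul_real {n k : ℕ} (h : k ≤ n) :
    (n.choose (k + 1) : ℝ) * (k + 1) = n.choose k * (n - k) := by
  have := Nat.choose_succ_right_eq n k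
  rw [← Nat.cast_sub h]
  exact_mod_cast this

lemma mul_invSqrtChoose_succ {n k : ℕ} (h : k < n) :
    ((k : ℝ) + 1) * invSqrtChoose n k =
      √(((k : ℝ) + 1) * (n - k)) * invSqrtChoose n (k + 1) := by
  have hk : (k : ℝ) < n := by exact_mod_cast h
  have h1 := choose_succ_mul_real h.le
  have h2 := invSqrtChoose_pos h.le
  have h3 := invSqrtChoose_pos (n := n) (m := k + 1) h
  have h4 : (0 : ℝ) < n.choose k := by exact_mod_cast Nat.choose_pos h.le
  have h5 : (0 : ℝ) < n.choose (k + 1) := by exact_mod_cast Nat.choose_pos h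
  have h6 : 0 ≤ (n : ℝ) - k := by linarith
  refine (pow_left_inj₀ (by positivity) (by positivity) two_ne_zero).1 ?_
  rw [mul_pow, mul_pow, Real.sq_sqrt (by positivity), invSqrtChoose_sq, invSqrtChoose_sq]
  field_simp
  linear_combination h1

/-- After squaring, the ratio of the binomial coefficients reduces this to
$(k+1)(n-k)\le(k+2)(n-k-1)$, that is $2k+2\le n$. -/
lemma invSqrtChoose_step {n k : ℕ} (h : 2 * (k + 2) ≤ n) :
    ((k : ℝ) + 1) * invSqrtChoose n k ≤ ((n : ℝ) - k - 1) * invSqrtChoose n (k + 2) := by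
  have hn : 2 * ((k : ℝ) + 2) ≤ n := by exact_mod_cast h
  have h1 := choose_succ_mul_real (n := n) (k := k) (by omega)
  have h2 := choose_succ_mul_real (n := n) (k := k + 1) (by omega)
  push_cast at h2
  have h4 : (0 : ℝ) < n.choose k := by exact_mod_cast Nat.choose_pos (by omega)
  have h5 : (0 : ℝ) < n.choose (k + 2) := by exact_mod_cast Nat.choose_pos (by omega)
  have h6 := invSqrtChoose_nonneg n (k + 2)
  have hk : (0 : ℝ) ≤ k := k.cast_nonneg
  have h7 : 0 ≤ (n : ℝ) - k - 1 := by linarith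
  refine (pow_le_pow_iff_left₀ (mul_nonneg (by positivity) (invSqrtChoose_nonneg _ _))
    (mul_nonneg h7 h6) two_ne_zero).1 ?_
  rw [mul_pow, mul_pow, invSqrtChoose_sq, invSqrtChoose_sq, ← div_eq_mul_inv, ← div_eq_mul_inv,
    div_le_div_iff₀ h4 h5]
  have h8 : (n.choose (k + 2) : ℝ) * ((k + 2) * (k + 1)) =
      n.choose k * ((n - k) * (n - k - 1)) := by
    linear_combination (k + 1) * h2 + ((n : ℝ) - k - 1) * h1
  have h9 : ((k : ℝ) + 1) * (n - k) ≤ (k + 2) * (n - k - 1) := by nlinarith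
  have h10 : ((k : ℝ) + 2) * ((k + 1) ^ 2 * n.choose (k + 2)) ≤
      (k + 2) * ((n - k - 1) ^ 2 * n.choose k) := by
    calc ((k : ℝ) + 2) * ((k + 1) ^ 2 * n.choose (k + 2))
        = (n.choose k * (n - k - 1)) * ((k + 1) * (n - k)) := by linear_combination (k + 1) * h8
      _ ≤ (n.choose k * (n - k - 1)) * ((k + 2) * (n - k - 1)) := by gcongr
      _ = _ := by ring
  exact le_of_mul_le_mul_left h10 (by positivity)

lemma invSqrtChoose_anti_step {n k : ℕ} (h : 2 * (k + 1) ≤ n) :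
    invSqrtChoose n (k + 1) ≤ invSqrtChoose n k := by
  have h1 : (n.choose k : ℝ) ≤ n.choose (k + 1) := by
    exact_mod_cast Nat.choose_le_succ_of_lt_half_left (by omega)
  have h4 : (0 : ℝ) < n.choose k := by exact_mod_cast Nat.choose_pos (by omega)
  unfold invSqrtChoose
  gcongr

lemma lossFactor_mono_step (n k : ℕ) : lossFactor n k ≤ lossFactor n (k + 1) := by
  unfold lossFactor
  gcongr <;> simp

/-- The exponent of `lossFactor` is chosen to telescope: its increment dominates
$1/(k+1)+17\sqrt{(k+2)/n}$, and $1+x\le e^x$ does the rest. -/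
lemma lossFactor_step (n k : ℕ) :
    (1 + 1 / ((k : ℝ) + 1) + 17 * √(((k : ℝ) + 2) / n)) * lossFactor n (k + 1) ≤
      lossFactor n (k + 2) := by
  set a := √((k : ℝ) + 1) with ha
  set b := √((k : ℝ) + 2) with hb
  have ha2 : a ^ 2 = k + 1 := Real.sq_sqrt (by positivity)
  have hb2 : b ^ 2 = k + 2 := Real.sq_sqrt (by positivity)
  have hk : (0 : ℝ) ≤ k := k.cast_nonneg
  have ha1 : 1 ≤ a := Real.one_le_sqrt.2 (by linarith)
  have hab : a ≤ b := Real.sqrt_le_sqrt (by linarith)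
  have hb2a : b ≤ 2 * a := by nlinarith
  have h1 : 1 / ((k : ℝ) + 1) ≤ 4 * b - 4 * a := by
    rw [← ha2, div_le_iff₀ (by positivity)]
    have h3 : (b - a) * (b + a) = 1 := by linear_combination hb2 - ha2
    have h4 : 1 ≤ (b - a) * (3 * a) := by
      rw [← h3]; gcongr
      · linarith
    nlinarith
  have h2 : 17 * √(((k : ℝ) + 2) / n) ≤
      17 * (((k : ℝ) + 2) * √(((k : ℝ) + 2) / n)) - 17 * (((k : ℝ) + 1) * √(((k : ℝ) + 1) / n)) := by
    have : √(((k : ℝ) + 1) / n) ≤ √(((k : ℝ) + 2) / n) :=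
      Real.sqrt_le_sqrt (by gcongr; norm_num)
    have := mul_le_mul_of_nonneg_left this (by positivity : 0 ≤ (k : ℝ) + 1)
    linarith
  have h3 : 1 + 1 / ((k : ℝ) + 1) + 17 * √(((k : ℝ) + 2) / n) ≤
      Real.exp (4 * b - 4 * a + (17 * (((k : ℝ) + 2) * √(((k : ℝ) + 2) / n)) -
        17 * (((k : ℝ) + 1) * √(((k : ℝ) + 1) / n)))) := by
    refine le_trans ?_ (Real.add_one_le_exp _)
    linarith
  refine (mul_le_mul_of_nonneg_right h3 (lossFactor_pos _ _).le).trans (le_of_eq ?_)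
  unfold lossFactor
  rw [← Real.exp_add]
  push_cast
  congr 1
  rw [hb, ha]
  ring

/-- The induction step shared by the refined supremum bound and the $L^2$ bound. The first term
stands for cancelling merges, the second for the others. The coefficient 12 is what the supremum
bound needs, and 17 in `lossFactor` works because $17^2>2\cdot12^2$ and $n-k-1\ge n/2$. -/
lemma invSqrtChoose_mul_lossFactor_step {n k : ℕ} (h : 2 * (k + 2) ≤ n) :
    ((k : ℝ) + 2) * (invSqrtChoose n k * lossFactor n k) +
      12 * (((k : ℝ) + 2) * (invSqrtChoose n (k + 1) * lossFactor n (k + 1))) ≤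
      ((n : ℝ) - k - 1) * (invSqrtChoose n (k + 2) * lossFactor n (k + 2)) := by
  have hn : 2 * ((k : ℝ) + 2) ≤ n := by exact_mod_cast h
  have hk : (0 : ℝ) ≤ k := k.cast_nonneg
  have hq : 0 < (n : ℝ) - k - 1 := by linarith
  have hB := invSqrtChoose_nonneg n (k + 2)
  have h1 : ((k : ℝ) + 2) * invSqrtChoose n k ≤
      (1 + 1 / ((k : ℝ) + 1)) * (((n : ℝ) - k - 1) * invSqrtChoose n (k + 2)) := by
    refine le_trans (le_of_eq ?_)
      (mul_le_mul_of_nonneg_left (invSqrtChoose_step h) (by positivity))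
    field_simp
    ring
  have h2 : 12 * (((k : ℝ) + 2) * invSqrtChoose n (k + 1)) ≤
      17 * √(((k : ℝ) + 2) / n) * (((n : ℝ) - k - 1) * invSqrtChoose n (k + 2)) := by
    have h3 := mul_invSqrtChoose_succ (n := n) (k := k + 1) (by omega)
    push_cast at h3
    have h4 : (k : ℝ) + 2 = k + 1 + 1 := by ring
    have h5 : (n : ℝ) - k - 1 = n - (k + 1) := by ring
    rw [h4, h3, ← h4, ← h5]
    have h6 : 12 * √(((k : ℝ) + 2) * (n - k - 1)) ≤
        17 * √(((k : ℝ) + 2) / n) * (n - k - 1) := by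
      have hn0 : (0 : ℝ) < n := by linarith
      refine (pow_le_pow_iff_left₀ (by positivity) (by positivity) two_ne_zero).1 ?_
      rw [mul_pow, mul_pow, mul_pow, Real.sq_sqrt (by positivity), Real.sq_sqrt (by positivity)]
      have h7 : 144 * (n : ℝ) ≤ 289 * (n - k - 1) := by linarith
      have h8 := mul_le_mul_of_nonneg_left h7 (by positivity : 0 ≤ ((k : ℝ) + 2) * (n - k - 1) / n)
      calc (12 : ℝ) ^ 2 * ((k + 2) * (n - k - 1)) = (k + 2) * (n - k - 1) / n * (144 * n) := by
            field_simp; ring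
        _ ≤ _ := h8
        _ = _ := by ring
    calc _ = (12 * √(((k : ℝ) + 2) * (n - k - 1))) * invSqrtChoose n (k + 2) := by ring
      _ ≤ (17 * √(((k : ℝ) + 2) / n) * (n - k - 1)) * invSqrtChoose n (k + 2) := by gcongr
      _ = _ := by ring
  have hL := (lossFactor_pos n (k + 1)).le
  calc ((k : ℝ) + 2) * (invSqrtChoose n k * lossFactor n k) +
      12 * (((k : ℝ) + 2) * (invSqrtChoose n (k + 1) * lossFactor n (k + 1)))
      ≤ ((k : ℝ) + 2) * (invSqrtChoose n k * lossFactor n (k + 1)) +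
      12 * (((k : ℝ) + 2) * (invSqrtChoose n (k + 1) * lossFactor n (k + 1))) := by
        have := invSqrtChoose_nonneg n k
        gcongr
        exact lossFactor_mono_step n k
    _ = (((k : ℝ) + 2) * invSqrtChoose n k + 12 * (((k : ℝ) + 2) * invSqrtChoose n (k + 1))) *
        lossFactor n (k + 1) := by ring
    _ ≤ ((1 + 1 / ((k : ℝ) + 1)) * (((n : ℝ) - k - 1) * invSqrtChoose n (k + 2)) +
        17 * √(((k : ℝ) + 2) / n) * (((n : ℝ) - k - 1) * invSqrtChoose n (k + 2))) *
        lossFactor n (k + 1) := by gcongr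
    _ = ((n : ℝ) - k - 1) * invSqrtChoose n (k + 2) *
        ((1 + 1 / ((k : ℝ) + 1) + 17 * √(((k : ℝ) + 2) / n)) * lossFactor n (k + 1)) := by ring
    _ ≤ ((n : ℝ) - k - 1) * invSqrtChoose n (k + 2) * lossFactor n (k + 2) :=
        mul_le_mul_of_nonneg_left (lossFactor_step n k) (mul_nonneg hq.le hB)
    _ = _ := by ring

/-- Here $c$ counts cancelling partners and $t$ is the allowed excess over the threshold $pm$. A
small excess is paid for by $pm+t\le pm\,e^t$. A larger one drops by $2(1-p)$, and then $c\le m$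
suffices since $p\,e^{2(1-p)}\ge p(3-2p)\ge1$ for $1/2\le p\le1$. -/
lemma mul_exp_le_of_threshold {c m p t : ℝ} (hp : 1 / 2 ≤ p) (hp1 : p ≤ 1) (ht : 0 ≤ t)
    (hc0 : 0 ≤ c) (hm : 1 ≤ p * m) (hc : c ≤ m) (hct : c ≤ p * m + t) :
    c * Real.exp (max 0 (t - 2 * (1 - p))) ≤ p * m * Real.exp t := by
  rcases le_total (t - 2 * (1 - p)) 0 with h | h
  · rw [max_eq_left h, Real.exp_zero, mul_one]
    have := Real.add_one_le_exp t
    nlinarith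
  · rw [max_eq_right h]
    have h1 : Real.exp t = Real.exp (2 * (1 - p)) * Real.exp (t - 2 * (1 - p)) := by
      rw [← Real.exp_add]; congr 1; ring
    rw [h1, ← mul_assoc]
    gcongr
    have h2 := Real.add_one_le_exp (2 * (1 - p))
    have h3 : 1 ≤ p * Real.exp (2 * (1 - p)) := by nlinarith
    have hm0 : 0 ≤ m := hc0.trans hc
    nlinarith

end Numeric

/-! ### Pointwise bounds, first with square-root cancellation and then beyond it. -/

section Bounds

variable {G ι : Type*} [AddCommGroup G] [Fintype G] [DecidableEq G] [Fintype ι] [DecidableEq ι]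

lemma bijMean_eq_one (hc : Fintype.card ι = Fintype.card G) {χ : ι → AddChar G ℂ}
    (h : (charSupport χ).card = 0) : bijMean χ = 1 := by
  have h0 : ∀ i, χ i = 0 := fun i => by
    by_contra hi
    exact (Finset.card_pos.2 ⟨i, mem_charSupport.2 hi⟩).ne' h
  have : ((Fintype.card G).factorial : ℂ) ≠ 0 := by exact_mod_cast Nat.factorial_ne_zero _
  simp [bijMean, h0, Fintype.card_equiv (Fintype.equivOfCardEq hc), hc, this]

lemma bijMean_eq_zero (hc : Fintype.card ι = Fintype.card G) {χ : ι → AddChar G ℂ}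
    (h : (charSupport χ).card = 1) : bijMean χ = 0 := by
  obtain ⟨i, hi⟩ := Finset.card_eq_one.1 h
  have hn : (0 : ℝ) < Fintype.card G := by exact_mod_cast Fintype.card_pos
  have h1 := norm_bijMean_le_sum_moveChar hc (χ := χ) (i := i) (by simp [hi])
  rw [h, hi] at h1
  simp only [Finset.erase_singleton, Finset.sum_empty] at h1
  have h2 : (Fintype.card G : ℝ) - (1 : ℕ) + 1 = Fintype.card G := by push_cast; ring
  rw [h2] at h1
  exact norm_le_zero_iff.1 (nonpos_of_mul_nonpos_right h1 hn)

lemma card_charSupport_moveChar_of_add_eq_zero {χ : ι → AddChar G ℂ} {i j : ι} {k : ℕ}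
    (hχ : (charSupport χ).card = k + 2) (hi : i ∈ charSupport χ)
    (hj : j ∈ (charSupport χ).erase i) (h : χ j + χ i = 0) :
    (charSupport (moveChar χ i j)).card = k := by
  rw [charSupport_moveChar_of_add_eq_zero (Finset.ne_of_mem_erase hj) h,
    Finset.card_erase_of_mem hj, Finset.card_erase_of_mem hi, hχ]
  omega

lemma card_charSupport_moveChar_of_add_ne_zero {χ : ι → AddChar G ℂ} {i j : ι} {k : ℕ}
    (hχ : (charSupport χ).card = k + 2) (hi : i ∈ charSupport χ)
    (hj : j ∈ (charSupport χ).erase i) (h : χ j + χ i ≠ 0) :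
    (charSupport (moveChar χ i j)).card = k + 1 := by
  rw [charSupport_moveChar_of_add_ne_zero (Finset.ne_of_mem_erase hj)
    (mem_charSupport.1 (Finset.mem_of_mem_erase hj)) h, Finset.card_erase_of_mem hi, hχ]
  omega

/-- Square-root cancellation for sparse characters. -/
theorem norm_bijMean_le (hc : Fintype.card ι = Fintype.card G) (m : ℕ) :
    ∀ χ : ι → AddChar G ℂ, 2 * m ≤ Fintype.card G → (charSupport χ).card = m →
      ‖bijMean χ‖ ≤ invSqrtChoose (Fintype.card G) m := by
  induction m using Nat.strong_induction_on with
  | _ m ih =>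
  intro χ hm hχ
  match m, ih, hm, hχ with
  | 0, _, _, hχ => simp [bijMean_eq_one hc hχ]
  | 1, _, _, hχ => simp [bijMean_eq_zero hc hχ, invSqrtChoose_nonneg]
  | k + 2, ih, hm, hχ =>
    set n := Fintype.card G
    obtain ⟨i, hi⟩ := Finset.card_pos.1 (by omega : 0 < (charSupport χ).card)
    have hn : 2 * ((k : ℝ) + 2) ≤ n := by exact_mod_cast hm
    have hk : (0 : ℝ) ≤ k := k.cast_nonneg
    have h1 := norm_bijMean_le_sum_moveChar hc hi
    -- Both kinds of merge are bounded by the value at $k$, since `invSqrtChoose` decreases in this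
    -- range.
    have h2 : ∑ j ∈ (charSupport χ).erase i, ‖bijMean (moveChar χ i j)‖ ≤
        ∑ j ∈ (charSupport χ).erase i, invSqrtChoose n k := by
      refine Finset.sum_le_sum fun j hj => ?_
      by_cases h : χ j + χ i = 0
      · exact ih k (by omega) _ (by omega) (card_charSupport_moveChar_of_add_eq_zero hχ hi hj h)
      · exact (ih (k + 1) (by omega) _ (by omega)
          (card_charSupport_moveChar_of_add_ne_zero hχ hi hj h)).trans
          (invSqrtChoose_anti_step (by omega))
    rw [Finset.sum_const, Finset.card_erase_of_mem hi, hχ, nsmul_eq_mul] at h2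
    have h3 := invSqrtChoose_step (n := n) (k := k) hm
    rw [hχ] at h1
    push_cast at h1 h2
    have h4 : ((n : ℝ) - k - 1) * ‖bijMean χ‖ ≤ (n - k - 1) * invSqrtChoose n (k + 2) := by
      linarith
    exact le_of_mul_le_mul_left h4 (by linarith)

/-- The choice of the index to be summed over in `norm_bijMean_le_of_card_charFiber_le`. -/
lemma exists_index_of_card_charFiber_le {χ : ι → AddChar G ℂ} {p t : ℝ} {k : ℕ}
    (hp : 1 / 2 ≤ p) (hp1 : p ≤ 1) (ht : 0 ≤ t) (hχ : (charSupport χ).card = k + 2)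
    (hf : ∀ ψ : AddChar G ℂ, ψ ≠ 0 → ψ + ψ = 0 →
      ((charFiber χ ψ).card : ℝ) ≤ max (p * (k + 2)) (((k : ℝ) + 2) / 2 + 1) + t) :
    ∃ i ∈ charSupport χ, ∃ t' : ℝ, 0 ≤ t' ∧
      (((charSupport χ).erase i).filter (fun j => χ j + χ i = 0)).card * Real.exp t' ≤
        p * (k + 2) * Real.exp t ∧
      ∀ j ∈ (charSupport χ).erase i, χ j + χ i = 0 → ∀ ψ : AddChar G ℂ, ψ ≠ 0 → ψ + ψ = 0 →
        ((charFiber (moveChar χ i j) ψ).card : ℝ) ≤ max (p * k) ((k : ℝ) / 2 + 1) + t' := by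
  have hk : (0 : ℝ) ≤ k := k.cast_nonneg
  -- Does some character of order 2 occupy more than half of the support? If so, $i$ is taken inside
  -- its fibre.
  by_cases hA : ∃ ψ : AddChar G ℂ, ψ ≠ 0 ∧ ψ + ψ = 0 ∧ k + 2 < 2 * (charFiber χ ψ).card
  · obtain ⟨ψ, hψ, hψψ, ha⟩ := hA
    obtain ⟨i, hi⟩ := Finset.card_pos.1 (by omega : 0 < (charFiber χ ψ).card)
    have hiψ := mem_charFiber.1 hi
    have hle := Finset.card_le_card (charFiber_subset_charSupport hψ (χ := χ))
    -- A cancelling merge removes two indices from the large fibre while the threshold $pm$ falls by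
    -- only $2p$, so the excess falls by $2(1-p)$.
    refine ⟨i, charFiber_subset_charSupport hψ hi, max 0 (t - 2 * (1 - p)), le_max_left _ _, ?_, ?_⟩
    · have hset : ((charSupport χ).erase i).filter (fun j => χ j + χ i = 0) =
          (charFiber χ ψ).erase i := by
        ext j
        have : χ j + ψ = 0 ↔ χ j = ψ := by
          rw [← hψψ, add_left_inj]
        simp only [Finset.mem_filter, Finset.mem_erase, mem_charSupport, hiψ, mem_charFiber, this]
        constructor
        · rintro ⟨⟨h1, _⟩, h2⟩; exact ⟨h1, h2⟩
        · rintro ⟨h1, h2⟩; exact ⟨⟨h1, h2 ▸ hψ⟩, h2⟩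
      rw [hset, Finset.card_erase_of_mem hi]
      have hcast : (((charFiber χ ψ).card - 1 : ℕ) : ℝ) = (charFiber χ ψ).card - 1 := by
        rw [Nat.cast_sub (by omega)]; simp
      have hle' : ((charFiber χ ψ).card : ℝ) ≤ k + 2 := by rw [hχ] at hle; exact_mod_cast hle
      have ha' : (k : ℝ) + 2 < 2 * (charFiber χ ψ).card := by exact_mod_cast ha
      rw [hcast]
      refine mul_exp_le_of_threshold hp hp1 ht (by linarith) (by nlinarith) (by linarith) ?_
      have h1 := hf ψ hψ hψψ
      -- The possible extra 1 in the threshold is absorbed because $i$ is not its own partner.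
      have h2 : max (p * (k + 2)) (((k : ℝ) + 2) / 2 + 1) ≤ p * (k + 2) + 1 :=
        max_le (by linarith) (by nlinarith)
      linarith
    · intro j hj hji φ hφ hφφ
      rw [charFiber_moveChar_of_add_eq_zero (Finset.ne_of_mem_erase hj) hji hφ]
      by_cases h : φ = ψ
      · subst h
        have hjφ : j ∈ (charFiber χ φ).erase i := by
          rw [Finset.mem_erase, mem_charFiber]
          refine ⟨Finset.ne_of_mem_erase hj, ?_⟩
          rw [hiψ, ← hφφ, add_left_inj] at hji
          exact hji
        rw [Finset.card_erase_of_mem hjφ, Finset.card_erase_of_mem hi]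
        have hcast : (((charFiber χ φ).card - 1 - 1 : ℕ) : ℝ) = (charFiber χ φ).card - 2 := by
          rw [Nat.sub_sub, Nat.cast_sub (by omega)]; simp
        rw [hcast]
        have h1 := hf φ hφ hφφ
        have h2 : max (p * (k + 2)) (((k : ℝ) + 2) / 2 + 1) ≤
            max (p * k) ((k : ℝ) / 2 + 1) + 2 * p := by
          refine max_le ?_ ?_
          · linarith [le_max_left (p * k) ((k : ℝ) / 2 + 1)]
          · linarith [le_max_right (p * k) ((k : ℝ) / 2 + 1)]
        linarith [le_max_right 0 (t - 2 * (1 - p))]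
      -- Any other fibre has at most $(k+2)/2=k/2+1$ elements. This is why the threshold includes
      -- $m/2+1$: such a fibre need not shrink in the merge.
      · have h1 := card_charFiber_add_card_charFiber_le hφ hψ h (χ := χ)
        have h2 : (((charFiber χ φ).erase i).erase j).card ≤ (charFiber χ φ).card :=
          (Finset.card_erase_le).trans Finset.card_erase_le
        have h3 : 2 * (((charFiber χ φ).erase i).erase j).card ≤ k + 2 := by omega
        have h4 : 2 * ((((charFiber χ φ).erase i).erase j).card : ℝ) ≤ k + 2 := by
          exact_mod_cast h3
        linarith [le_max_left 0 (t - 2 * (1 - p)), le_max_right (p * k) ((k : ℝ) / 2 + 1)]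
  · push Not at hA
    have hex : ∃ i ∈ charSupport χ, 2 * ((((charSupport χ).erase i).filter
        (fun j => χ j + χ i = 0)).card) ≤ k + 2 := by
      have hsub : ∀ i, ((charSupport χ).erase i).filter (fun j => χ j + χ i = 0) ⊆
          charFiber χ (-χ i) := fun i j hj => by
        rw [mem_charFiber]
        exact eq_neg_of_add_eq_zero_left (Finset.mem_filter.1 hj).2
      obtain ⟨i, hi⟩ := Finset.card_pos.1 (by omega : 0 < (charSupport χ).card)
      have hi0 := mem_charSupport.1 hi
      by_cases hs : 2 * (charFiber χ (-χ i)).card ≤ k + 2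
      · refine ⟨i, hi, ?_⟩
        have := Finset.card_le_card (hsub i)
        omega
      -- With no large fibre of order 2, a large fibre of $-\chi_i$ is disjoint from that of
      -- $\chi_i$. Choosing the index in the large fibre instead leaves at most half the support as
      -- partners.
      · have hne : χ i ≠ -χ i := fun h => by
          refine hs (hA _ (neg_ne_zero.2 hi0) ?_)
          rw [← h]
          nth_rewrite 2 [h]
          exact add_neg_cancel _
        have h1 := card_charFiber_add_card_charFiber_le hi0 (neg_ne_zero.2 hi0) hne (χ := χ)
        obtain ⟨j, hj⟩ := Finset.card_pos.1 (by omega : 0 < (charFiber χ (-χ i)).card)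
        refine ⟨j, charFiber_subset_charSupport (neg_ne_zero.2 hi0) hj, ?_⟩
        have h2 := Finset.card_le_card (hsub j)
        rw [mem_charFiber.1 hj, neg_neg] at h2
        rw [mem_charFiber.1 hj]
        omega
    obtain ⟨i, hi, hic⟩ := hex
    refine ⟨i, hi, t, ht, ?_, ?_⟩
    · gcongr
      have : 2 * ((((charSupport χ).erase i).filter (fun j => χ j + χ i = 0)).card : ℝ) ≤ k + 2 := by
        exact_mod_cast hic
      nlinarith
    · intro j hj hji φ hφ hφφ
      rw [charFiber_moveChar_of_add_eq_zero (Finset.ne_of_mem_erase hj) hji hφ]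
      have h1 := hA φ hφ hφφ
      have h2 : (((charFiber χ φ).erase i).erase j).card ≤ (charFiber χ φ).card :=
        (Finset.card_erase_le).trans Finset.card_erase_le
      have h4 : 2 * ((((charFiber χ φ).erase i).erase j).card : ℝ) ≤ k + 2 := by
        exact_mod_cast (by omega : 2 * (((charFiber χ φ).erase i).erase j).card ≤ k + 2)
      linarith [le_max_right (p * k) ((k : ℝ) / 2 + 1)]

/-- Cancellation beyond the square root for sparse characters without a dominant coordinate. -/
theorem norm_bijMean_le_of_card_charFiber_le (hc : Fintype.card ι = Fintype.card G) {s : ℝ}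
    (hs0 : 0 ≤ s) (hs : 1 / 2 ≤ s ^ 2) (hs1 : s ≤ 1) (m : ℕ) :
    ∀ (χ : ι → AddChar G ℂ) (t : ℝ), 0 ≤ t → 2 * m ≤ Fintype.card G →
      (charSupport χ).card = m →
      (∀ ψ : AddChar G ℂ, ψ ≠ 0 → ψ + ψ = 0 →
        ((charFiber χ ψ).card : ℝ) ≤ max (s ^ 2 * m) ((m : ℝ) / 2 + 1) + t) →
      ‖bijMean χ‖ ≤ s ^ m * Real.exp t *
        (invSqrtChoose (Fintype.card G) m * lossFactor (Fintype.card G) m) := by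
  induction m using Nat.strong_induction_on with
  | _ m ih =>
  intro χ t ht hm hχ hf
  match m, ih, hm, hχ, hf with
  | 0, _, _, hχ, _ =>
    have h1 := one_le_lossFactor (Fintype.card G) 0
    have h2 := Real.one_le_exp ht
    simp only [bijMean_eq_one hc hχ, norm_one, pow_zero, invSqrtChoose_zero, one_mul]
    nlinarith
  | 1, _, _, hχ, _ =>
    rw [bijMean_eq_zero hc hχ, norm_zero]
    have h1 := (lossFactor_pos (Fintype.card G) 1).le
    have h2 := invSqrtChoose_nonneg (Fintype.card G) 1
    positivity
  | k + 2, ih, hm, hχ, hf =>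
    set n := Fintype.card G
    have hk : (0 : ℝ) ≤ k := k.cast_nonneg
    have hn : 2 * ((k : ℝ) + 2) ≤ n := by exact_mod_cast hm
    have hp1 : s ^ 2 ≤ 1 := pow_le_one₀ hs0 hs1
    push_cast at hf
    obtain ⟨i, hi, t', ht', hct, hfib⟩ := exists_index_of_card_charFiber_le hs hp1 ht hχ hf
    have h1 := norm_bijMean_le_sum_moveChar hc hi
    rw [← Finset.sum_filter_add_sum_filter_not _ (fun j => χ j + χ i = 0), hχ] at h1
    push_cast at h1
    set W₀ := invSqrtChoose n k * lossFactor n k with hW₀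
    set W₁ := invSqrtChoose n (k + 1) * lossFactor n (k + 1) with hW₁
    have hW₀0 : 0 ≤ W₀ := mul_nonneg (invSqrtChoose_nonneg _ _) (lossFactor_pos _ _).le
    have hW₁0 : 0 ≤ W₁ := mul_nonneg (invSqrtChoose_nonneg _ _) (lossFactor_pos _ _).le
    have h2 : ∑ j ∈ ((charSupport χ).erase i).filter (fun j => χ j + χ i = 0),
        ‖bijMean (moveChar χ i j)‖ ≤ s ^ (k + 2) * Real.exp t * ((k + 2) * W₀) := by
      calc _ ≤ ∑ j ∈ ((charSupport χ).erase i).filter (fun j => χ j + χ i = 0),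
            (s ^ k * Real.exp t' * W₀) := by
            refine Finset.sum_le_sum fun j hj => ?_
            obtain ⟨hj, h⟩ := Finset.mem_filter.1 hj
            exact ih k (by omega) _ t' ht' (by omega)
              (card_charSupport_moveChar_of_add_eq_zero hχ hi hj h) (hfib j hj h)
        _ = (((charSupport χ).erase i).filter (fun j => χ j + χ i = 0)).card * Real.exp t' *
            (s ^ k * W₀) := by rw [Finset.sum_const, nsmul_eq_mul]; ring
        _ ≤ s ^ 2 * (k + 2) * Real.exp t * (s ^ k * W₀) := by gcongr
        _ = _ := by ring
    have h3 : ∑ j ∈ ((charSupport χ).erase i).filter (fun j => ¬ χ j + χ i = 0),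
        ‖bijMean (moveChar χ i j)‖ ≤ s ^ (k + 2) * Real.exp t * (12 * ((k + 2) * W₁)) := by
      -- A non-cancelling merge may enlarge a fibre by 1 and lowers the threshold by at most 1, so
      -- the excess grows by at most 2. Since $s\ge0.7$, the cost $e^2$ is at most $12s$.
      have hexp : s ^ (k + 1) * Real.exp (t + 2) ≤ 12 * (s ^ (k + 2) * Real.exp t) := by
        have he : Real.exp 2 ≤ 7.4 := by
          have h1 := Real.exp_one_lt_d9
          have h2 : Real.exp 2 = Real.exp 1 * Real.exp 1 := by rw [← Real.exp_add]; norm_num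
          rw [h2]
          have := Real.exp_pos 1
          nlinarith
        have hs7 : 0.7 ≤ s := by nlinarith
        rw [Real.exp_add]
        have : Real.exp 2 ≤ 12 * s := by linarith
        calc s ^ (k + 1) * (Real.exp t * Real.exp 2) ≤ s ^ (k + 1) * (Real.exp t * (12 * s)) := by
              gcongr
          _ = _ := by ring
      calc _ ≤ ∑ j ∈ ((charSupport χ).erase i).filter (fun j => ¬ χ j + χ i = 0),
            (s ^ (k + 1) * Real.exp (t + 2) * W₁) := by
            refine Finset.sum_le_sum fun j hj => ?_
            obtain ⟨hj, h⟩ := Finset.mem_filter.1 hj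
            refine ih (k + 1) (by omega) _ (t + 2) (by linarith) (by omega)
              (card_charSupport_moveChar_of_add_ne_zero hχ hi hj h) fun ψ hψ hψψ => ?_
            have h4 := (Finset.card_le_card (charFiber_moveChar_subset
              (Finset.ne_of_mem_erase hj) hψ (χ := χ))).trans (Finset.card_insert_le _ _)
            have h5 : ((charFiber (moveChar χ i j) ψ).card : ℝ) ≤ (charFiber χ ψ).card + 1 := by
              exact_mod_cast h4
            have h6 := hf ψ hψ hψψ
            have h7 : max (s ^ 2 * ((k : ℝ) + 2)) (((k : ℝ) + 2) / 2 + 1) ≤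
                max (s ^ 2 * ((k + 1 : ℕ) : ℝ)) (((k + 1 : ℕ) : ℝ) / 2 + 1) + 1 := by
              push_cast
              refine max_le ?_ ?_
              · linarith [le_max_left (s ^ 2 * ((k : ℝ) + 1)) (((k : ℝ) + 1) / 2 + 1)]
              · linarith [le_max_right (s ^ 2 * ((k : ℝ) + 1)) (((k : ℝ) + 1) / 2 + 1)]
            linarith
        _ = (((charSupport χ).erase i).filter (fun j => ¬ χ j + χ i = 0)).card *
            ((s ^ (k + 1) * Real.exp (t + 2)) * W₁) := by rw [Finset.sum_const, nsmul_eq_mul]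
        _ ≤ (k + 2) * ((12 * (s ^ (k + 2) * Real.exp t)) * W₁) := by
            gcongr
            have h4 := (Finset.card_filter_le ((charSupport χ).erase i)
              (fun j => ¬ χ j + χ i = 0)).trans Finset.card_erase_le
            rw [hχ] at h4
            exact_mod_cast h4
        _ = _ := by ring
    have h4 := mul_le_mul_of_nonneg_left (invSqrtChoose_mul_lossFactor_step (n := n) (k := k) hm)
      (by positivity : 0 ≤ s ^ (k + 2) * Real.exp t)
    refine le_of_mul_le_mul_left (a := (n : ℝ) - k - 1) ?_ (by linarith)
    rw [← hW₀, ← hW₁] at h4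
    linarith

end Bounds

/-! ### Exact $L^2$ mass of the means on a given support. -/

section Parseval

variable {G ι : Type*} [AddCommGroup G] [Fintype G] [DecidableEq G] [Fintype ι] [DecidableEq ι]

/-- Composing with $\sigma^{-1}$ turns these bijections into the permutations that fix $A$
pointwise. -/
lemma card_equiv_eqOn (hc : Fintype.card ι = Fintype.card G) (A : Finset ι) (σ : ι ≃ G) :
    (Finset.univ.filter fun π : ι ≃ G => ∀ i ∈ A, π i = σ i).card =
      (Fintype.card G - A.card).factorial := by
  have h1 : Fintype.card (Equiv.Perm {i // i ∉ A}) = (Fintype.card G - A.card).factorial := by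
    rw [Fintype.card_perm, Fintype.card_subtype_compl, hc, Fintype.card_coe]
  rw [← h1, Fintype.card_congr (Equiv.Perm.subtypeEquivSubtypePerm (fun i => i ∉ A)),
    Fintype.card_subtype]
  refine Finset.card_bij' (fun π _ => π.trans σ.symm) (fun f _ => f.trans σ) ?_ ?_ ?_ ?_
  · intro π hπ
    simp only [Finset.mem_filter, Finset.mem_univ, true_and] at hπ ⊢
    intro i hi
    simp [hπ i (not_not.1 hi)]
  · intro f hf
    simp only [Finset.mem_filter, Finset.mem_univ, true_and] at hf ⊢
    intro i hi
    simp [hf i (not_not.2 hi)]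
  · intro π _; ext i; simp
  · intro f _; ext i; simp

/-- Expanding the square gives a double sum over $\sigma,\pi$. Orthogonality of characters at each
index of $A$ keeps only pairs that agree on $A$, each with weight $n^{|A|}$. -/
lemma sum_charSupport_subset_norm_sq (hc : Fintype.card ι = Fintype.card G) (A : Finset ι) :
    ∑ χ : ι → AddChar G ℂ with charSupport χ ⊆ A, ‖bijMean χ‖ ^ 2 =
      (Fintype.card G : ℝ) ^ A.card * (Fintype.card G - A.card).factorial /
        (Fintype.card G).factorial := by
  set n := Fintype.card G with hn
  have hset : (Finset.univ.filter fun χ : ι → AddChar G ℂ => charSupport χ ⊆ A) =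
      Fintype.piFinset (fun i => if i ∈ A then Finset.univ else {0}) := by
    ext χ
    simp only [Finset.mem_filter, Finset.mem_univ, true_and, Fintype.mem_piFinset]
    refine ⟨fun h i => ?_, fun h i hi => ?_⟩
    · split_ifs with hi
      · simp
      · by_contra h0
        exact hi (h (mem_charSupport.2 (by simpa using h0)))
    · by_contra hiA
      have := h i
      rw [if_neg hiA, Finset.mem_singleton] at this
      exact mem_charSupport.1 hi this
  have hmain : ∑ χ ∈ (Fintype.piFinset (fun i => if i ∈ A then Finset.univ else {0}) :
      Finset (ι → AddChar G ℂ)),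
      ((∑ π : ι ≃ G, ∏ i, χ i (π i)) * (starRingEnd ℂ) (∑ π : ι ≃ G, ∏ i, χ i (π i))) =
      (n : ℂ) ^ A.card * (n - A.card).factorial * n.factorial := by
    have h1 : ∀ χ : ι → AddChar G ℂ,
        ((∑ π : ι ≃ G, ∏ i, χ i (π i)) * (starRingEnd ℂ) (∑ π : ι ≃ G, ∏ i, χ i (π i))) =
        ∑ σ : ι ≃ G, ∑ π : ι ≃ G, ∏ i, χ i (π i - σ i) := fun χ => by
      rw [map_sum, Finset.sum_mul_sum, Finset.sum_comm]
      refine Finset.sum_congr rfl fun σ _ => Finset.sum_congr rfl fun π _ => ?_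
      rw [map_prod, ← Finset.prod_mul_distrib]
      refine Finset.prod_congr rfl fun i _ => ?_
      rw [← AddChar.map_neg_eq_conj, ← AddChar.map_add_eq_mul, sub_eq_add_neg]
    simp_rw [h1]
    rw [Finset.sum_comm]
    have h2 : ∀ σ : ι ≃ G,
        ∑ χ ∈ (Fintype.piFinset (fun i => if i ∈ A then Finset.univ else {0}) :
      Finset (ι → AddChar G ℂ)),
          ∑ π : ι ≃ G, ∏ i, χ i (π i - σ i) =
        (n : ℂ) ^ A.card * (n - A.card).factorial := fun σ => by
      rw [Finset.sum_comm]
      have h3 : ∀ π : ι ≃ G,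
          ∑ χ ∈ (Fintype.piFinset (fun i => if i ∈ A then Finset.univ else {0}) :
      Finset (ι → AddChar G ℂ)),
            ∏ i, χ i (π i - σ i) =
          if ∀ i ∈ A, π i = σ i then (n : ℂ) ^ A.card else 0 := fun π => by
        rw [← Finset.prod_univ_sum (fun i => if i ∈ A then Finset.univ else {0})
          (fun i (ψ : AddChar G ℂ) => ψ (π i - σ i))]
        have h4 : ∀ i, ∑ ψ ∈ (if i ∈ A then Finset.univ else {0} : Finset (AddChar G ℂ)),
            ψ (π i - σ i) = if i ∈ A then (if π i = σ i then (n : ℂ) else 0) else 1 := fun i => by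
          split_ifs with h h'
          · rw [AddChar.sum_apply_eq_ite, if_pos (sub_eq_zero.2 h')]
          · rw [AddChar.sum_apply_eq_ite, if_neg (sub_ne_zero.2 h')]
          · simp
        simp_rw [h4]
        rw [Finset.prod_ite_mem, Finset.univ_inter]
        split_ifs with h
        · rw [Finset.prod_congr rfl (fun i hi => if_pos (h i hi)), Finset.prod_const]
        · push Not at h
          obtain ⟨i, hi, hne⟩ := h
          exact Finset.prod_eq_zero hi (if_neg hne)
      simp_rw [h3]
      rw [← Finset.sum_filter, Finset.sum_const, card_equiv_eqOn hc, nsmul_eq_mul, mul_comm]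
    simp_rw [h2]
    rw [Finset.sum_const, Finset.card_univ, Fintype.card_equiv (Fintype.equivOfCardEq hc), hc,
      nsmul_eq_mul, mul_comm]
  have h0 : (n.factorial : ℂ) ≠ 0 := by exact_mod_cast n.factorial_ne_zero
  rw [hset]
  apply Complex.ofReal_injective
  push_cast
  have h5 : ∀ χ : ι → AddChar G ℂ, (‖bijMean χ‖ : ℂ) ^ 2 =
      ((n.factorial : ℂ) ^ 2)⁻¹ * ((∑ π : ι ≃ G, ∏ i, χ i (π i)) *
        (starRingEnd ℂ) (∑ π : ι ≃ G, ∏ i, χ i (π i))) := fun χ => by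
    rw [← Complex.mul_conj']
    unfold bijMean
    rw [map_mul, map_inv₀, Complex.conj_natCast, ← hn]
    field_simp
  simp_rw [h5]
  rw [← Finset.mul_sum, hmain]
  field_simp

/-- The mass `∑ |bijMean χ| ^ 2` over the `χ` supported in a set of size `k`. -/
noncomputable def subsetMass (n k : ℕ) : ℝ := (n : ℝ) ^ k * (n - k).factorial / n.factorial

/-- The mass `∑ |bijMean χ| ^ 2` over the `χ` with support a given set of size `m`. -/
noncomputable def exactMass (n m : ℕ) : ℝ := (fwdDiff (1 : ℕ))^[m] (subsetMass n) 0

/-- Both sides, summed over the subsets of $A$, give `subsetMass`: the left by the previous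
evaluation, the right by Newton's forward difference formula. Strong induction on $A$ then
identifies them. -/
lemma sum_charSupport_eq_norm_sq (hc : Fintype.card ι = Fintype.card G) (A : Finset ι) :
    ∑ χ : ι → AddChar G ℂ with charSupport χ = A, ‖bijMean χ‖ ^ 2 =
      exactMass (Fintype.card G) A.card := by
  induction A using Finset.strongInduction with
  | H A ih =>
  set n := Fintype.card G
  have h1 : ∑ B ∈ A.powerset, ∑ χ : ι → AddChar G ℂ with charSupport χ = B, ‖bijMean χ‖ ^ 2 =
      subsetMass n A.card := by
    rw [subsetMass, ← sum_charSupport_subset_norm_sq hc A, ← Finset.sum_fiberwise_of_maps_to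
      (g := charSupport) (t := A.powerset) (fun χ hχ => by simpa using hχ)]
    refine Finset.sum_congr rfl fun B hB => ?_
    rw [Finset.filter_filter]
    refine Finset.sum_congr (Finset.filter_congr fun χ _ => ?_) fun _ _ => rfl
    constructor
    · rintro rfl; exact ⟨by simpa using hB, rfl⟩
    · exact And.right
  have h2 : ∑ B ∈ A.powerset, exactMass n B.card = subsetMass n A.card := by
    have := shift_eq_sum_fwdDiff_iter (1 : ℕ) (subsetMass n) A.card 0
    simp only [smul_eq_mul, mul_one, zero_add] at this
    rw [this, Finset.sum_powerset_apply_card]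
    rfl
  rw [← Finset.add_sum_erase _ _ (Finset.mem_powerset_self A)] at h1 h2
  have h3 : ∑ B ∈ A.powerset.erase A,
      ∑ χ : ι → AddChar G ℂ with charSupport χ = B, ‖bijMean χ‖ ^ 2 =
      ∑ B ∈ A.powerset.erase A, exactMass n B.card := by
    refine Finset.sum_congr rfl fun B hB => ih B ?_
    rw [Finset.mem_erase, Finset.mem_powerset] at hB
    exact hB.2.ssubset_of_ne hB.1
  linarith

lemma sum_card_charSupport_eq_norm_sq (hc : Fintype.card ι = Fintype.card G) (m : ℕ) :
    ∑ χ : ι → AddChar G ℂ with (charSupport χ).card = m, ‖bijMean χ‖ ^ 2 =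
      (Fintype.card G).choose m * exactMass (Fintype.card G) m := by
  rw [← Finset.sum_fiberwise_of_maps_to (g := charSupport) (t := Finset.univ.powersetCard m)
    (fun χ hχ => by simpa [Finset.mem_powersetCard] using hχ)]
  have : ∀ A ∈ (Finset.univ : Finset ι).powersetCard m,
      ∑ χ ∈ Finset.univ.filter (fun χ : ι → AddChar G ℂ => (charSupport χ).card = m) with
        charSupport χ = A, ‖bijMean χ‖ ^ 2 = exactMass (Fintype.card G) m := fun A hA => by
    obtain ⟨-, hA⟩ := Finset.mem_powersetCard.1 hA
    rw [← hA, ← sum_charSupport_eq_norm_sq hc A, Finset.filter_filter]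
    refine Finset.sum_congr (Finset.filter_congr fun χ _ => ?_) fun _ _ => rfl
    constructor
    · exact And.right
    · rintro rfl; exact ⟨rfl, rfl⟩
  rw [Finset.sum_congr rfl this, Finset.sum_const, Finset.card_powersetCard, Finset.card_univ, hc,
    nsmul_eq_mul]

end Parseval

/-! ### Three-term recurrence for the exact mass and its bound. -/

section Recursion

lemma subsetMass_succ {n k : ℕ} (h : k < n) :
    ((n : ℝ) - k) * subsetMass n (k + 1) = n * subsetMass n k := by
  have h1 : (n - k).factorial = (n - k) * (n - (k + 1)).factorial := by
    rw [← Nat.mul_factorial_pred (by omega : n - k ≠ 0)]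
    congr 2
  have h2 : ((n - k : ℕ) : ℝ) = n - k := Nat.cast_sub h.le
  have h3 : ((n - k).factorial : ℝ) = (n - k) * (n - (k + 1)).factorial := by
    rw [h1]; push_cast; rw [h2]
  unfold subsetMass
  rw [h3]
  ring

lemma iterate_fwdDiff_succ (f : ℕ → ℝ) (m k : ℕ) :
    (fwdDiff (1 : ℕ))^[m + 1] f k = (fwdDiff (1 : ℕ))^[m] f (k + 1) - (fwdDiff (1 : ℕ))^[m] f k := by
  rw [Function.iterate_succ_apply']
  rfl

/-- This is the iterated difference of the first-order relation $(n-k)f(k+1)=nf(k)$. Only $k=0$ is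
needed later, but the induction on $m$ passes from $k$ to $k+1$. -/
lemma iterate_fwdDiff_subsetMass (n m : ℕ) : ∀ k, k + m + 2 ≤ n →
    ((n : ℝ) - k) * (fwdDiff (1 : ℕ))^[m + 2] (subsetMass n) k -
      (m + 1) * (fwdDiff (1 : ℕ))^[m + 1] (subsetMass n) (k + 1) =
    k * (fwdDiff (1 : ℕ))^[m + 1] (subsetMass n) k +
      (m + 1) * (fwdDiff (1 : ℕ))^[m] (subsetMass n) (k + 1) := by
  induction m with
  | zero =>
    intro k hk
    have h1 := subsetMass_succ (n := n) (k := k) (by omega)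
    have h2 := subsetMass_succ (n := n) (k := k + 1) (by omega)
    push_cast at h2
    simp only [iterate_fwdDiff_succ, Function.iterate_zero, id_eq, Nat.cast_zero]
    linear_combination h2 - h1
  | succ m ih =>
    intro k hk
    have h1 := ih k (by omega)
    have h2 := ih (k + 1) (by omega)
    push_cast at h2 ⊢
    have e := iterate_fwdDiff_succ (subsetMass n)
    rw [e (m + 1 + 1)]
    have e1 := e (m + 1) (k + 1)
    have e2 := e (m + 1) k
    have e3 := e m (k + 1)
    simp only [show m + 2 = m + 1 + 1 from rfl] at h1 h2 ⊢
    linear_combination h2 - h1 - (m + 1) * e1 - (m + 1) * e3 - k * e2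

lemma exactMass_zero (n : ℕ) : exactMass n 0 = 1 := by
  have : (n.factorial : ℝ) ≠ 0 := by exact_mod_cast n.factorial_ne_zero
  simp [exactMass, subsetMass, this]

lemma exactMass_one {n : ℕ} (h : 0 < n) : exactMass n 1 = 0 := by
  have h1 := subsetMass_succ (n := n) (k := 0) h
  have h2 : (n : ℝ) ≠ 0 := by exact_mod_cast h.ne'
  have h3 : exactMass n 1 = subsetMass n 1 - subsetMass n 0 := rfl
  rw [h3, sub_eq_zero]
  simpa [h2] using h1

lemma exactMass_succ_succ {n m : ℕ} (h : m + 2 ≤ n) :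
    ((n : ℝ) - m - 1) * exactMass n (m + 2) =
      (m + 1) * (exactMass n m + 2 * exactMass n (m + 1)) := by
  have h1 := iterate_fwdDiff_subsetMass n m 0 (by omega)
  have e1 := iterate_fwdDiff_succ (subsetMass n) (m + 1) 0
  have e2 := iterate_fwdDiff_succ (subsetMass n) m 0
  unfold exactMass
  push_cast at h1
  linear_combination h1 - (m + 1) * e1 - (m + 1) * e2

/-- The restriction of Parseval's identity to sparse characters. -/
theorem exactMass_le (n m : ℕ) (hn : 0 < n) (hm : 2 * m ≤ n) :
    exactMass n m ≤ invSqrtChoose n m * lossFactor n m := by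
  induction m using Nat.strong_induction_on with
  | _ m ih =>
  match m, ih, hm with
  | 0, _, _ => simpa [exactMass_zero] using one_le_lossFactor n 0
  | 1, _, _ =>
    rw [exactMass_one hn]
    exact mul_nonneg (invSqrtChoose_nonneg _ _) (lossFactor_pos _ _).le
  | k + 2, ih, hm =>
    have hk : (0 : ℝ) ≤ k := k.cast_nonneg
    have hn' : 2 * ((k : ℝ) + 2) ≤ n := by exact_mod_cast hm
    have h0 := ih k (by omega) (by omega)
    have h1 := ih (k + 1) (by omega) (by omega)
    have hW₀ := mul_nonneg (invSqrtChoose_nonneg n k) (lossFactor_pos n k).le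
    have hW₁ := mul_nonneg (invSqrtChoose_nonneg n (k + 1)) (lossFactor_pos n (k + 1)).le
    refine le_of_mul_le_mul_left (a := (n : ℝ) - k - 1) ?_ (by linarith)
    rw [exactMass_succ_succ (by omega)]
    refine le_trans ?_ (invSqrtChoose_mul_lossFactor_step hm)
    have h2 := mul_le_mul_of_nonneg_left h0 (by positivity : 0 ≤ (k : ℝ) + 1)
    have h3 := mul_le_mul_of_nonneg_left h1 (by positivity : 0 ≤ (k : ℝ) + 1)
    have h4 := mul_nonneg hk hW₁
    linarith

end Recursion

/-! ### The cubic sum, split by the presence of a dominant value. -/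

section SparseSum

variable {G ι : Type*} [AddCommGroup G] [Fintype G] [DecidableEq G] [Fintype ι] [DecidableEq ι]

/-- The number of sparse characters with a dominant nontrivial coordinate. -/
lemma card_dominant_le (hc : Fintype.card ι = Fintype.card G) {δ : ℝ} (hδ : 0 ≤ δ) (m : ℕ)
    {s : Finset (ι → AddChar G ℂ)}
    (hs : ∀ χ ∈ s, (charSupport χ).card = m ∧
      ∃ ψ : AddChar G ℂ, ψ ≠ 0 ∧ (1 - δ) * m < (charFiber χ ψ).card) :
    (s.card : ℝ) ≤
      (Fintype.card G).choose m * (2 ^ m * (Fintype.card G : ℝ) ^ (δ * m + 1)) := by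
  classical
  set n := Fintype.card G with hn
  have hn0 : 0 < n := Fintype.card_pos
  let X : Finset ι → Finset ι → AddChar G ℂ → Finset (ι → AddChar G ℂ) := fun A T ψ =>
    Fintype.piFinset fun i => if i ∈ A \ T then Finset.univ else if i ∈ T then {ψ} else {0}
  have hX : ∀ A T ψ, (X A T ψ).card = n ^ (A \ T).card := fun A T ψ => by
    have : ∀ i, (if i ∈ A \ T then Finset.univ else if i ∈ T then {ψ} else {0} :
        Finset (AddChar G ℂ)).card = if i ∈ A \ T then n else 1 := fun i => by
      split_ifs
      · rw [Finset.card_univ, AddChar.card_eq]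
      · simp
      · simp
    simp only [X, Fintype.card_piFinset, this, Finset.prod_ite_mem, Finset.univ_inter,
      Finset.prod_const]
  -- Each $\chi$ is encoded by its support $A$, the fibre $T\subseteq A$ of the dominant $\psi$, the
  -- character $\psi$, and at most $\delta m$ free values on $A\setminus T$.
  have hsub : s ⊆ ((Finset.univ : Finset ι).powersetCard m).biUnion fun A =>
      (A.powerset.filter fun T => (A \ T).card ≤ ⌊δ * m⌋₊).biUnion fun T =>
        (Finset.univ : Finset (AddChar G ℂ)).biUnion fun ψ => X A T ψ := by
    intro χ hχ
    obtain ⟨hm, ψ, hψ, hlt⟩ := hs χ hχ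
    have hfs := charFiber_subset_charSupport hψ (χ := χ)
    simp only [Finset.mem_biUnion, Finset.mem_powersetCard, Finset.mem_filter,
      Finset.mem_powerset, Finset.mem_univ, true_and]
    refine ⟨charSupport χ, ⟨Finset.subset_univ _, hm⟩, charFiber χ ψ, ⟨hfs, ?_⟩, ψ, ?_⟩
    · refine Nat.le_floor ?_
      rw [Finset.card_sdiff_of_subset hfs, Nat.cast_sub (Finset.card_le_card hfs), hm]
      linarith
    · rw [Fintype.mem_piFinset]
      intro i
      split_ifs with h1 h2
      · simp
      · simpa using h2
      · simp only [Finset.mem_sdiff, not_and, not_not] at h1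
        have := mt h1 h2
        simpa using this
  have hcard : s.card ≤ n.choose m * (2 ^ m * (n * n ^ ⌊δ * m⌋₊)) := by
    refine (Finset.card_le_card hsub).trans ?_
    have h1 : ((Finset.univ : Finset ι).powersetCard m).card = n.choose m := by
      rw [Finset.card_powersetCard, Finset.card_univ, hc]
    rw [← h1]
    refine Finset.card_biUnion_le_card_mul _ _ _ fun A hA => ?_
    have hA' := (Finset.mem_powersetCard.1 hA).2
    have h2 : (A.powerset.filter fun T => (A \ T).card ≤ ⌊δ * m⌋₊).card ≤ 2 ^ m := by
      refine (Finset.card_filter_le _ _).trans ?_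
      rw [Finset.card_powerset, hA']
    refine le_trans (Finset.card_biUnion_le_card_mul _ _ _ fun T hT => ?_)
      (Nat.mul_le_mul_right _ h2)
    have h3 : (Finset.univ : Finset (AddChar G ℂ)).card = n := by
      rw [Finset.card_univ, AddChar.card_eq]
    conv_rhs => rw [← h3]
    refine Finset.card_biUnion_le_card_mul _ _ _ fun ψ _ => ?_
    rw [hX]
    exact (Nat.pow_le_pow_right hn0 (Finset.mem_filter.1 hT).2).trans_eq (by rw [h3])
  have h4 : (s.card : ℝ) ≤ n.choose m * (2 ^ m * (n * (n : ℝ) ^ ⌊δ * m⌋₊)) := by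
    exact_mod_cast hcard
  have hn1 : (1 : ℝ) ≤ n := by exact_mod_cast hn0
  have h5 : (n : ℝ) ^ ⌊δ * m⌋₊ ≤ (n : ℝ) ^ (δ * m) := by
    rw [← Real.rpow_natCast]
    exact Real.rpow_le_rpow_of_exponent_le hn1 (Nat.floor_le (by positivity))
  refine h4.trans ?_
  rw [Real.rpow_add (by positivity), Real.rpow_one, mul_comm ((n : ℝ) ^ (δ * m))]
  gcongr

/-- The cubic sum over `m`-sparse characters. -/
theorem sum_norm_bijMean_cube_le (hc : Fintype.card ι = Fintype.card G) {δ : ℝ} (hδ : 0 ≤ δ)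
    (hδ2 : δ ≤ 1 / 2) {m : ℕ} (hm : 2 * m ≤ Fintype.card G) :
    ∑ χ : ι → AddChar G ℂ with (charSupport χ).card = m, ‖bijMean χ‖ ^ 3 ≤
      √(1 - δ) ^ m * lossFactor (Fintype.card G) m ^ 2 +
        2 ^ m * (Fintype.card G : ℝ) ^ (δ * m + 1) * invSqrtChoose (Fintype.card G) m := by
  classical
  set n := Fintype.card G with hn
  have hn0 : 0 < n := Fintype.card_pos
  have hB := invSqrtChoose_nonneg n m
  have hL := (lossFactor_pos n m).le
  have hch : (n.choose m : ℝ) * invSqrtChoose n m ^ 2 = 1 := by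
    rw [invSqrtChoose_sq, mul_inv_cancel₀]
    exact_mod_cast (Nat.choose_pos (by omega)).ne'
  have hs2 : √(1 - δ) ^ 2 = 1 - δ := Real.sq_sqrt (by linarith)
  rw [add_comm, ← Finset.sum_filter_add_sum_filter_not _
    (fun χ => ∃ ψ : AddChar G ℂ, ψ ≠ 0 ∧ (1 - δ) * m < (charFiber χ ψ).card)]
  refine add_le_add ?_ ?_
  · have h1 := card_dominant_le hc hδ m (s := (Finset.univ.filter
      fun χ : ι → AddChar G ℂ => (charSupport χ).card = m).filter
      (fun χ => ∃ ψ : AddChar G ℂ, ψ ≠ 0 ∧ (1 - δ) * m < (charFiber χ ψ).card))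
      (fun χ hχ => by simpa using hχ)
    refine (Finset.sum_le_card_nsmul _ _ (invSqrtChoose n m ^ 3) fun χ hχ => ?_).trans ?_
    · simp only [Finset.mem_filter, Finset.mem_univ, true_and] at hχ
      exact pow_le_pow_left₀ (norm_nonneg _) (norm_bijMean_le hc m χ hm hχ.1) 3
    · rw [nsmul_eq_mul]
      refine (mul_le_mul_of_nonneg_right h1 (by positivity)).trans (le_of_eq ?_)
      linear_combination (2 ^ m * (n : ℝ) ^ (δ * m + 1) * invSqrtChoose n m) * hch
  · have h2 : ∀ χ ∈ (Finset.univ.filter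
        fun χ : ι → AddChar G ℂ => (charSupport χ).card = m).filter
        (fun χ => ¬ ∃ ψ : AddChar G ℂ, ψ ≠ 0 ∧ (1 - δ) * m < (charFiber χ ψ).card),
        ‖bijMean χ‖ ^ 3 ≤
          √(1 - δ) ^ m * (invSqrtChoose n m * lossFactor n m) * ‖bijMean χ‖ ^ 2 := fun χ hχ => by
      simp only [Finset.mem_filter, Finset.mem_univ, true_and] at hχ
      obtain ⟨hχm, hχ⟩ := hχ
      push Not at hχ
      -- Absence of a dominant value means no initial excess, so $t=0$.
      have h3 := norm_bijMean_le_of_card_charFiber_le hc (Real.sqrt_nonneg (1 - δ))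
        (by rw [hs2]; linarith) (Real.sqrt_le_one.2 (by linarith)) m χ 0 le_rfl hm hχm
        (fun ψ hψ _ => by
          rw [hs2, add_zero]
          exact (hχ ψ hψ).trans (le_max_left _ _))
      rw [Real.exp_zero, mul_one] at h3
      rw [pow_succ']
      exact mul_le_mul_of_nonneg_right h3 (by positivity)
    refine (Finset.sum_le_sum h2).trans ?_
    rw [← Finset.mul_sum]
    have h4 : ∑ χ ∈ (Finset.univ.filter
        fun χ : ι → AddChar G ℂ => (charSupport χ).card = m).filter
        (fun χ => ¬ ∃ ψ : AddChar G ℂ, ψ ≠ 0 ∧ (1 - δ) * m < (charFiber χ ψ).card),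
        ‖bijMean χ‖ ^ 2 ≤ n.choose m * (invSqrtChoose n m * lossFactor n m) := by
      refine (Finset.sum_le_sum_of_subset_of_nonneg (Finset.filter_subset _ _)
        fun _ _ _ => by positivity).trans ?_
      rw [sum_card_charSupport_eq_norm_sq hc]
      gcongr
      exact exactMass_le n m hn0 hm
    refine (mul_le_mul_of_nonneg_left h4 (by positivity)).trans (le_of_eq ?_)
    linear_combination (√(1 - δ) ^ m * lossFactor n m ^ 2) * hch

/-- A trivial bound, used for the finitely many small $n$. -/
lemma sum_norm_bijMean_cube_le_card_pow (hc : Fintype.card ι = Fintype.card G) (m : ℕ) :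
    ∑ χ : ι → AddChar G ℂ with (charSupport χ).card = m, ‖bijMean χ‖ ^ 3 ≤
      (Fintype.card G : ℝ) ^ Fintype.card G := by
  refine (Finset.sum_le_card_nsmul _ _ 1 fun χ _ =>
    pow_le_one₀ (norm_nonneg _) (norm_bijMean_le_one hc χ)).trans ?_
  rw [nsmul_eq_mul, mul_one]
  have h1 := Finset.card_filter_le (Finset.univ : Finset (ι → AddChar G ℂ))
    (fun χ => (charSupport χ).card = m)
  rw [Finset.card_univ, Fintype.card_fun, AddChar.card_eq, hc] at h1
  exact_mod_cast h1

end SparseSum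

/-! ### Part (i), by rewriting the loss and the binomial factor as real powers. -/

section FirstPart

lemma lossFactor_sq_le (n m : ℕ) :
    lossFactor n m ^ 2 ≤
      Real.exp (34 * ((m : ℝ) ^ (3 / 2 : ℝ) / (n : ℝ) ^ (1 / 2 : ℝ) + (m : ℝ) ^ (1 / 2 : ℝ))) := by
  unfold lossFactor
  rw [← Real.exp_nat_mul, ← Real.sqrt_eq_rpow, ← Real.sqrt_eq_rpow]
  have h1 : (m : ℝ) ^ (3 / 2 : ℝ) = m * √m := by
    rw [show (3 / 2 : ℝ) = 1 + 1 / 2 by norm_num, Real.rpow_add_of_nonneg (by positivity)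
      (by norm_num) (by norm_num), Real.rpow_one, ← Real.sqrt_eq_rpow]
  rw [h1, Real.sqrt_div (by positivity)]
  refine Real.exp_le_exp.2 ?_
  have h2 : 0 ≤ √(m : ℝ) := Real.sqrt_nonneg _
  push_cast
  rw [mul_div_assoc]
  linarith

lemma invSqrtChoose_eq_rpow (n m : ℕ) :
    invSqrtChoose n m = (n.choose m : ℝ) ^ (-(1 / 2) : ℝ) := by
  rw [invSqrtChoose, Real.sqrt_eq_rpow, Real.rpow_neg (by positivity)]

lemma sqrt_pow_eq_rpow {x : ℝ} (hx : 0 ≤ x) (m : ℕ) : √x ^ m = x ^ ((m : ℝ) / 2) := by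
  rw [Real.sqrt_eq_rpow, ← Real.rpow_natCast, ← Real.rpow_mul hx]
  congr 1
  ring

theorem sparseCubeSum_le (G : Type*) [AddCommGroup G] [Fintype G] {n : ℕ}
    (hn : n = Fintype.card G) {δ : ℝ} (hδ : 0 ≤ δ) (hδ2 : δ ≤ 1 / 2) {m : ℕ}
    (hm : (m : ℝ) ≤ (n : ℝ) / 2) :
    sparseCubeSum G m ≤
      Real.exp (34 * ((m : ℝ) ^ (3 / 2 : ℝ) / (n : ℝ) ^ (1 / 2 : ℝ) + (m : ℝ) ^ (1 / 2 : ℝ))) *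
          (1 - δ) ^ ((m : ℝ) / 2) * ((n.factorial : ℝ) / (n : ℝ) ^ n) ^ 3 +
        2 ^ m * (n : ℝ) ^ (δ * (m : ℝ) + 1) * (n.choose m : ℝ) ^ (-(1 / 2) : ℝ) *
          ((n.factorial : ℝ) / (n : ℝ) ^ n) ^ 3 := by
  classical
  subst hn
  have hm' : 2 * m ≤ Fintype.card G := by
    have : 2 * (m : ℝ) ≤ Fintype.card G := by linarith
    exact_mod_cast this
  rw [sparseCubeSum_eq, ← add_mul]
  refine mul_le_mul_of_nonneg_right ?_ (by positivity)
  refine (sum_norm_bijMean_cube_le (by simp) hδ hδ2 hm').trans ?_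
  rw [← invSqrtChoose_eq_rpow, ← sqrt_pow_eq_rpow (by linarith), mul_comm (√(1 - δ) ^ m)]
  gcongr
  exact lossFactor_sq_le _ _

end FirstPart

/-! ### Choice of $\delta$ and the asymptotic estimates for part (ii). -/

section Asymptotics

/-- This is $(n/m)^m\le\binom nm$. The induction uses $\frac{n+1}{m+1}\le\frac nm$ for $m\le n$. -/
lemma pow_le_choose_mul_pow (m : ℕ) : ∀ n : ℕ, m ≤ n →
    (n : ℝ) ^ m ≤ n.choose m * (m : ℝ) ^ m := by
  induction m with
  | zero => intro n _; simp
  | succ m ih =>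
    intro n hmn
    obtain ⟨n, rfl⟩ : ∃ k, n = k + 1 := ⟨n - 1, by omega⟩
    have hmn' : (m : ℝ) ≤ n := by exact_mod_cast (by omega : m ≤ n)
    have h1 : ((n + 1 : ℕ) : ℝ) * n.choose m = (n + 1).choose (m + 1) * ((m + 1 : ℕ) : ℝ) := by
      exact_mod_cast Nat.add_one_mul_choose_eq n m
    have hm0 : (0 : ℝ) ≤ m := m.cast_nonneg
    rcases Nat.eq_zero_or_pos m with rfl | hm
    · simp
    have hm' : (0 : ℝ) < m := by exact_mod_cast hm
    have h2 : (((n + 1 : ℕ) : ℝ) * m) ^ m ≤ (((m + 1 : ℕ) : ℝ) * n) ^ m := by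
      refine pow_le_pow_left₀ (by positivity) ?_ m
      push_cast; nlinarith
    have h3 := ih n (by omega)
    refine le_of_mul_le_mul_left (a := (m : ℝ) ^ m) ?_ (by positivity)
    calc (m : ℝ) ^ m * ((n + 1 : ℕ) : ℝ) ^ (m + 1)
        = ((n + 1 : ℕ) : ℝ) * (((n + 1 : ℕ) : ℝ) * m) ^ m := by rw [mul_pow]; ring
      _ ≤ ((n + 1 : ℕ) : ℝ) * (((m + 1 : ℕ) : ℝ) * n) ^ m := by gcongr
      _ = ((n + 1 : ℕ) : ℝ) * ((m + 1 : ℕ) : ℝ) ^ m * (n : ℝ) ^ m := by rw [mul_pow]; ring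
      _ ≤ ((n + 1 : ℕ) : ℝ) * ((m + 1 : ℕ) : ℝ) ^ m * (n.choose m * (m : ℝ) ^ m) := by gcongr
      _ = (((n + 1 : ℕ) : ℝ) * n.choose m) * ((m + 1 : ℕ) : ℝ) ^ m * (m : ℝ) ^ m := by ring
      _ = (m : ℝ) ^ m * ((n + 1).choose (m + 1) * ((m + 1 : ℕ) : ℝ) ^ (m + 1)) := by
          rw [h1]; ring

lemma invSqrtChoose_le_exp {n m : ℕ} (hm : 0 < m) (hmn : m ≤ n) :
    invSqrtChoose n m ≤ Real.exp (-(Real.log (n / m) * m / 2)) := by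
  have hm' : (0 : ℝ) < m := by exact_mod_cast hm
  have hn' : (0 : ℝ) < n := by exact_mod_cast (hm.trans_le hmn)
  have hc : (0 : ℝ) < n.choose m := by exact_mod_cast Nat.choose_pos hmn
  refine (pow_le_pow_iff_left₀ (invSqrtChoose_nonneg n m) (Real.exp_pos _).le two_ne_zero).1 ?_
  rw [invSqrtChoose_sq, ← Real.exp_nat_mul]
  have h1 : Real.exp (((2 : ℕ) : ℝ) * -(Real.log (n / m) * m / 2)) = (((n : ℝ) / m) ^ m)⁻¹ := by
    rw [← Real.exp_log (show (0 : ℝ) < ((n : ℝ) / m) ^ m by positivity), ← Real.exp_neg,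
      Real.log_pow]
    congr 1
    push_cast
    ring
  rw [h1]
  refine inv_anti₀ (by positivity) ?_
  rw [div_pow, div_le_iff₀ (by positivity)]
  exact pow_le_choose_mul_pow m n hmn

/-- The bound for the cubic sum with `δ = log (n / m) / (4 * log n)`. -/
lemma exists_cube_bound {n m : ℕ} (hn : 2 ≤ n) (hm : 0 < m) (hmn : m ≤ n) :
    ∃ δ : ℝ, 0 ≤ δ ∧ δ ≤ 1 / 2 ∧
      √(1 - δ) ^ m * lossFactor n m ^ 2 + 2 ^ m * (n : ℝ) ^ (δ * m + 1) * invSqrtChoose n m ≤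
        Real.exp (8 * √(m : ℝ) + 34 * (m * √((m : ℝ) / n)) -
          Real.log (n / m) * m / (8 * Real.log n)) +
        Real.exp (m + Real.log n - Real.log (n / m) * m / 4) := by
  have hm' : (0 : ℝ) < m := by exact_mod_cast hm
  have hm1 : (1 : ℝ) ≤ m := by exact_mod_cast hm
  have hmn' : (m : ℝ) ≤ n := by exact_mod_cast hmn
  have hn' : (1 : ℝ) < n := by exact_mod_cast hn
  have hl : 0 < Real.log n := Real.log_pos hn'
  have hL0 : 0 ≤ Real.log (n / m) := Real.log_nonneg ((one_le_div hm').2 hmn')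
  have hL1 : Real.log (n / m) ≤ Real.log n :=
    Real.log_le_log (by positivity) (div_le_self (by linarith) hm1)
  set l := Real.log n with hl_def
  set L := Real.log (n / m) with hL_def
  have hδ1 : L / (4 * l) ≤ 1 / 2 := by
    rw [div_le_iff₀ (by positivity)]; linarith
  -- With this $\delta$, $n^{\delta m}=(n/m)^{m/4}$, which uses up half of the saving $(n/m)^{-m/2}$
  -- from the binomial coefficient.
  refine ⟨L / (4 * l), by positivity, hδ1, add_le_add ?_ ?_⟩
  · have h1 : √(1 - L / (4 * l)) ≤ Real.exp (-(L / (4 * l)) / 2) := by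
      rw [Real.exp_half]
      exact Real.sqrt_le_sqrt (Real.one_sub_le_exp_neg _)
    have h2 : √(1 - L / (4 * l)) ^ m ≤ Real.exp (-(L / (4 * l)) / 2) ^ m :=
      pow_le_pow_left₀ (Real.sqrt_nonneg _) h1 m
    refine (mul_le_mul_of_nonneg_right h2 (by positivity)).trans (le_of_eq ?_)
    rw [lossFactor, ← Real.exp_nat_mul, ← Real.exp_nat_mul, ← Real.exp_add]
    congr 1
    push_cast
    field_simp
    ring
  · have h1 : (2 : ℝ) ^ m ≤ Real.exp m := by
      rw [← mul_one (m : ℝ), Real.exp_nat_mul]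
      refine pow_le_pow_left₀ (by norm_num) ?_ m
      have := Real.add_one_le_exp (1 : ℝ)
      linarith
    have h2 : (n : ℝ) ^ (L / (4 * l) * m + 1) = Real.exp (L * m / 4 + l) := by
      rw [Real.rpow_def_of_pos (by linarith)]
      congr 1
      rw [← hl_def]
      field_simp
    rw [h2]
    calc _ ≤ Real.exp m * Real.exp (L * m / 4 + l) * Real.exp (-(L * m / 2)) := by
          gcongr
          · exact invSqrtChoose_nonneg n m
          · exact invSqrtChoose_le_exp hm hmn
      _ = _ := by
          rw [← Real.exp_add, ← Real.exp_add]
          congr 1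
          ring

/-- The range $m\le n^{3/4}$, with $q=n^{1/8}$. Here $\log(n/m)\ge\frac14\log n$, so the gain is at
least $m/32$. The conditions $m\ge2^{20}$ and $q\ge4352=34\cdot128$ make each loss at most $m/128$,
leaving $m/64$. -/
lemma cube_bound_of_small {n m : ℕ} {q : ℝ} (hq : q ^ 8 = n) (hq1 : 4352 ≤ q)
    (hl : 64 ≤ Real.log n) (hm : 2 ^ 20 ≤ m) (hmq : (m : ℝ) ≤ q ^ 6) :
    Real.exp (8 * √(m : ℝ) + 34 * (m * √((m : ℝ) / n)) -
        Real.log (n / m) * m / (8 * Real.log n)) +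
      Real.exp (m + Real.log n - Real.log (n / m) * m / 4) ≤
      2 * Real.exp (-(1 / 64)) ^ m := by
  have hmR : (2 : ℝ) ^ 20 ≤ m := by exact_mod_cast hm
  have hm0 : (0 : ℝ) < m := lt_of_lt_of_le (by norm_num) hmR
  have hq0 : 0 < q := by linarith
  have hlq : Real.log n = 8 * Real.log q := by
    rw [← hq, Real.log_pow]; norm_num
  have hL : Real.log n / 4 ≤ Real.log (n / m) := by
    have h1 : q ^ 2 ≤ (n : ℝ) / m := by
      rw [le_div_iff₀ hm0, ← hq]
      calc q ^ 2 * m ≤ q ^ 2 * q ^ 6 := by gcongr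
        _ = q ^ 8 := by ring
    have h2 := Real.log_le_log (by positivity) h1
    rw [Real.log_pow] at h2
    push_cast at h2
    linarith
  have hy : √((m : ℝ) / n) ≤ 1 / 4352 := by
    have h1 : √((m : ℝ) / n) ≤ 1 / q := by
      refine Real.sqrt_le_iff.2 ⟨by positivity, ?_⟩
      rw [← hq, div_le_iff₀ (by positivity)]
      refine hmq.trans (le_of_eq ?_)
      field_simp
    exact h1.trans (one_div_le_one_div_of_le (by norm_num) hq1)
  have hs : 8 * √(m : ℝ) ≤ m / 128 := by
    have h1 : 1024 ≤ √(m : ℝ) := Real.le_sqrt_of_sq_le (by linarith)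
    have h2 := Real.mul_self_sqrt hm0.le
    nlinarith
  set l := Real.log n with hl_def
  set L := Real.log (n / m) with hL_def
  have h1 : (m : ℝ) / 32 ≤ L * m / (8 * l) := by
    rw [le_div_iff₀ (by linarith)]
    nlinarith
  have hexp : Real.exp (-(1 / 64)) ^ m = Real.exp (-(m / 64)) := by
    rw [← Real.exp_nat_mul]; congr 1; ring
  rw [hexp, two_mul]
  refine add_le_add (Real.exp_le_exp.2 ?_) (Real.exp_le_exp.2 ?_)
  · have h2 := mul_le_mul_of_nonneg_left hy hm0.le
    linarith
  · have h2 := mul_le_mul_of_nonneg_right hL hm0.le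
    nlinarith

/-- The range $n^{3/4}<m\le n/(\log n)^2$. With $l=\log n$, the losses are at most $(8+34)m/l$,
while $\log(n/m)\ge2\log\log n\ge552$ gives a gain of $69m/l$. The surplus exceeds $m/l\ge
q^4=n^{1/2}$. -/
lemma cube_bound_of_large {n m : ℕ} {q : ℝ} (hq : q ^ 8 = n) (hq1 : 4352 ≤ q)
    (hlq : Real.log n ≤ q ^ 2) (hll : 276 ≤ Real.log (Real.log n)) (hl : 64 ≤ Real.log n)
    (hmn : (m : ℝ) ≤ n / Real.log n ^ 2) (hmq : q ^ 6 < m) :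
    Real.exp (8 * √(m : ℝ) + 34 * (m * √((m : ℝ) / n)) -
        Real.log (n / m) * m / (8 * Real.log n)) +
      Real.exp (m + Real.log n - Real.log (n / m) * m / 4) ≤
      2 * Real.exp (-q ^ 4) := by
  have hq0 : 0 < q := by linarith
  have hm0 : (0 : ℝ) < m := lt_trans (by positivity) hmq
  have hn0 : (0 : ℝ) < n := by rw [← hq]; positivity
  set l := Real.log n with hl_def
  have hl0 : 0 < l := by linarith
  have hml : (m : ℝ) * l ^ 2 ≤ n := (le_div_iff₀ (by positivity)).1 hmn
  have hL : 552 ≤ Real.log (n / m) := by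
    have h1 : l ^ 2 ≤ (n : ℝ) / m := by
      rw [le_div_iff₀ hm0]; linarith
    have h2 := Real.log_le_log (by positivity) h1
    rw [Real.log_pow] at h2
    push_cast at h2
    linarith
  set L := Real.log (n / m) with hL_def
  have hy : √((m : ℝ) / n) ≤ 1 / l := by
    refine Real.sqrt_le_iff.2 ⟨by positivity, ?_⟩
    rw [div_le_iff₀ hn0, one_div, inv_pow, inv_mul_eq_div, le_div_iff₀ (by positivity)]
    exact hml
  have hs : √(m : ℝ) ≤ m / l := by
    have h1 : l ≤ √(m : ℝ) := by
      refine Real.le_sqrt_of_sq_le ?_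
      calc l ^ 2 ≤ (q ^ 2) ^ 2 := by gcongr
        _ = q ^ 4 := by ring
        _ ≤ q ^ 6 := pow_le_pow_right₀ (by linarith) (by norm_num)
        _ ≤ m := hmq.le
    rw [le_div_iff₀ hl0]
    calc √(m : ℝ) * l ≤ √(m : ℝ) * √(m : ℝ) := by gcongr
      _ = m := Real.mul_self_sqrt hm0.le
  have h4 : q ^ 4 ≤ m / l := by
    rw [le_div_iff₀ hl0]
    calc q ^ 4 * l ≤ q ^ 4 * q ^ 2 := by gcongr
      _ = q ^ 6 := by ring
      _ ≤ m := hmq.le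
  have h69 : 69 * (m / l) ≤ L * m / (8 * l) := by
    have : L * m / (8 * l) = L / 8 * (m / l) := by field_simp
    rw [this]
    gcongr
    linarith
  rw [two_mul]
  refine add_le_add (Real.exp_le_exp.2 ?_) (Real.exp_le_exp.2 ?_)
  · have h2 := mul_le_mul_of_nonneg_left hy hm0.le
    rw [mul_one_div] at h2
    linarith [show 0 ≤ (m : ℝ) / l by positivity]
  · have h2 := mul_le_mul_of_nonneg_right hL hm0.le
    have h5 : m / l ≤ (m : ℝ) := div_le_self hm0.le (by linarith)
    have h6 : l ≤ q ^ 4 := hlq.trans (pow_le_pow_right₀ (by linarith) (by norm_num))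
    linarith

lemma eventually_cube_conditions :
    ∀ᶠ n : ℕ in Filter.atTop, 4352 ≤ (n : ℝ) ^ (1 / 8 : ℝ) ∧
      Real.log n ≤ ((n : ℝ) ^ (1 / 8 : ℝ)) ^ 2 ∧ 276 ≤ Real.log (Real.log n) ∧
      64 ≤ Real.log n := by
  have hcast := tendsto_natCast_atTop_atTop (R := ℝ)
  have h1 := ((tendsto_rpow_atTop (by norm_num : (0 : ℝ) < 1 / 8)).comp hcast).eventually_ge_atTop
    4352
  have hlog := Real.tendsto_log_atTop.comp hcast
  have h2 := (Real.tendsto_log_atTop.comp hlog).eventually_ge_atTop 276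
  have h3 := hlog.eventually_ge_atTop 64
  have h4 := hcast.eventually
    ((isLittleO_log_rpow_atTop (by norm_num : (0 : ℝ) < 1 / 4)).bound one_pos)
  filter_upwards [h1, h2, h3, h4] with n h1 h2 h3 h4
  refine ⟨h1, ?_, h2, h3⟩
  have h5 : ((n : ℝ) ^ (1 / 8 : ℝ)) ^ 2 = (n : ℝ) ^ (1 / 4 : ℝ) := by
    rw [← Real.rpow_natCast, ← Real.rpow_mul (by positivity)]
    norm_num
  rw [h5]
  simp only [Function.comp_apply] at h3
  rw [one_mul, Real.norm_of_nonneg (by linarith), Real.norm_of_nonneg (by positivity)] at h4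
  exact h4

lemma sum_cube_bound_le {n M : ℕ} {f : ℕ → ℝ} {q : ℝ} (hq : q ^ 8 = n) (hq1 : 4352 ≤ q)
    (hlq : Real.log n ≤ q ^ 2) (hl : 64 ≤ Real.log n)
    (hf : ∀ m ∈ Finset.Icc M ⌊(n : ℝ) / Real.log n ^ 2⌋₊,
      f m ≤ 2 * Real.exp (-(1 / 64)) ^ m + 2 * Real.exp (-q ^ 4)) :
    ∑ m ∈ Finset.Icc M ⌊(n : ℝ) / Real.log n ^ 2⌋₊, f m ≤
      2 / (1 - Real.exp (-(1 / 64))) * Real.exp (-(1 / 64)) ^ M +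
        2 * Real.exp (-(1 / 2) * (n : ℝ) ^ (1 / 2 : ℝ)) := by
  have hq0 : 0 < q := by linarith
  have hn0 : (0 : ℝ) < n := by rw [← hq]; positivity
  have hsqrt : (n : ℝ) ^ (1 / 2 : ℝ) = q ^ 4 := by
    rw [← Real.sqrt_eq_rpow, ← hq, show q ^ 8 = (q ^ 4) ^ 2 by ring, Real.sqrt_sq (by positivity)]
  have hη : Real.exp (-(1 / 64)) < 1 := Real.exp_lt_one_iff.2 (by norm_num)
  set N := ⌊(n : ℝ) / Real.log n ^ 2⌋₊ with hN
  have hNn : (N : ℝ) + 1 ≤ n := by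
    have h1 : (N : ℝ) ≤ n / Real.log n ^ 2 := Nat.floor_le (by positivity)
    have h2 : (n : ℝ) / Real.log n ^ 2 ≤ n / 2 := by
      refine div_le_div_of_nonneg_left hn0.le (by norm_num) ?_
      nlinarith
    have h3 : (2 : ℝ) ≤ n := by
      rw [← hq]
      calc (2 : ℝ) ≤ q := by linarith
        _ ≤ q ^ 8 := le_self_pow₀ (by linarith) (by norm_num)
    linarith
  refine (Finset.sum_le_sum hf).trans ?_
  rw [Finset.sum_add_distrib, ← Finset.mul_sum, Finset.sum_const, nsmul_eq_mul]
  refine add_le_add ?_ ?_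
  · have h1 : ∑ m ∈ Finset.Icc M N, Real.exp (-(1 / 64)) ^ m ≤
        Real.exp (-(1 / 64)) ^ M / (1 - Real.exp (-(1 / 64))) := by
      have := geom_sum_Ico_le_of_lt_one (m := M) (n := N + 1) (Real.exp_pos (-(1 / 64))).le hη
      rwa [Finset.Ico_add_one_right_eq_Icc] at this
    calc _ ≤ 2 * (Real.exp (-(1 / 64)) ^ M / (1 - Real.exp (-(1 / 64)))) := by gcongr
      _ = _ := by ring
  · have h1 : ((Finset.Icc M N).card : ℝ) ≤ n := by
      rw [Nat.card_Icc]
      refine le_trans ?_ hNn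
      exact_mod_cast Nat.sub_le _ _
    -- The number of terms is at most $n\le e^{q^4/2}$, so half of the exponent $q^4$ is spent on
    -- summing over $m$.
    have h2 : (n : ℝ) ≤ Real.exp (q ^ 4 / 2) := by
      rw [← Real.exp_log hn0]
      refine Real.exp_le_exp.2 (hlq.trans ?_)
      nlinarith [sq_nonneg q]
    rw [hsqrt]
    calc _ ≤ Real.exp (q ^ 4 / 2) * (2 * Real.exp (-q ^ 4)) := by
          gcongr
          exact h1.trans h2
      _ = 2 * (Real.exp (q ^ 4 / 2) * Real.exp (-q ^ 4)) := by ring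
      _ = _ := by
          rw [← Real.exp_add]
          congr 2
          ring

end Asymptotics

/-! ### Part (ii): summation over $m$. -/

section SecondPart

/-- The sum of `|bijMean χ| ^ 3` over all `m`-sparse `χ`. -/
noncomputable def sparseMeanCubeSum (G : Type*) [AddCommGroup G] [Fintype G] [DecidableEq G]
    (m : ℕ) : ℝ :=
  ∑ χ : Fin (Fintype.card G) → AddChar G ℂ with (charSupport χ).card = m, ‖bijMean χ‖ ^ 3

lemma sparseMeanCubeSum_le_of_large {G : Type*} [AddCommGroup G] [Fintype G] [DecidableEq G]
    {n m : ℕ} (hn : n = Fintype.card G)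
    (hq1 : 4352 ≤ (n : ℝ) ^ (1 / 8 : ℝ)) (hlq : Real.log n ≤ ((n : ℝ) ^ (1 / 8 : ℝ)) ^ 2)
    (hll : 276 ≤ Real.log (Real.log n)) (hl : 64 ≤ Real.log n) (hm : 2 ^ 20 ≤ m)
    (hmn : (m : ℝ) ≤ n / Real.log n ^ 2) :
    sparseMeanCubeSum G m ≤
      2 * Real.exp (-(1 / 64)) ^ m + 2 * Real.exp (-((n : ℝ) ^ (1 / 8 : ℝ)) ^ 4) := by
  set q := (n : ℝ) ^ (1 / 8 : ℝ) with hq_def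
  have hq : q ^ 8 = n := by
    rw [hq_def, ← Real.rpow_natCast, ← Real.rpow_mul (by positivity)]
    norm_num
  have hm2 : 2 * m ≤ n := by
    have h1 : (n : ℝ) / Real.log n ^ 2 ≤ n / 2 := by
      refine div_le_div_of_nonneg_left (by positivity) (by norm_num) ?_
      nlinarith
    have h2 : 2 * (m : ℝ) ≤ n := by linarith
    exact_mod_cast h2
  obtain ⟨δ, hδ, hδ2, hb⟩ := exists_cube_bound (n := n) (m := m) (by omega) (by omega) (by omega)
  have h1 : sparseMeanCubeSum G m ≤ _ :=
    (sum_norm_bijMean_cube_le (by simp) hδ hδ2 (hn ▸ hm2)).trans (hn ▸ hb)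
  rw [← hn] at h1
  rcases le_or_gt (m : ℝ) (q ^ 6) with h | h
  · have := cube_bound_of_small hq hq1 hl hm h
    have h2 := Real.exp_pos (-q ^ 4)
    linarith
  · have := cube_bound_of_large hq hq1 hlq hll hl hmn h
    have h2 := pow_pos (Real.exp_pos (-(1 / 64))) m
    linarith

theorem exists_sum_sparseMeanCubeSum_le :
    ∃ K : ℝ, 0 < K ∧ ∀ (G : Type u) [AddCommGroup G] [Fintype G] [DecidableEq G] (n : ℕ),
      n = Fintype.card G → ∀ M : ℕ, 2 ^ 20 ≤ M →
        ∑ m ∈ Finset.Icc M ⌊(n : ℝ) / Real.log n ^ 2⌋₊, sparseMeanCubeSum G m ≤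
          K * Real.exp (-(1 / 64)) ^ M + K * Real.exp (-(1 / 2) * (n : ℝ) ^ (1 / 2 : ℝ)) := by
  obtain ⟨N, hN⟩ := Filter.eventually_atTop.1 eventually_cube_conditions
  -- For $n$ below the asymptotic threshold, `g n` times $e^{-n^{1/2}/2}$ is the trivial bound on
  -- the whole sum. Adding these finitely many values to $K$ covers the small groups.
  set g : ℕ → ℝ := fun n => (⌊(n : ℝ) / Real.log n ^ 2⌋₊ + 1) * (n : ℝ) ^ n *
    Real.exp (1 / 2 * (n : ℝ) ^ (1 / 2 : ℝ)) with hg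
  have hg0 : ∀ n, 0 ≤ g n := fun n => by rw [hg]; positivity
  have hη : 0 < 1 - Real.exp (-(1 / 64)) := sub_pos.2 (Real.exp_lt_one_iff.2 (by norm_num))
  have hsum : 0 ≤ ∑ n ∈ Finset.range N, g n := Finset.sum_nonneg fun n _ => hg0 n
  have hK1 : 0 < 2 / (1 - Real.exp (-(1 / 64))) := by positivity
  refine ⟨2 / (1 - Real.exp (-(1 / 64))) + 2 + ∑ n ∈ Finset.range N, g n, by positivity, ?_⟩
  intro G _ _ _ n hn M hM
  have hpow := pow_pos (Real.exp_pos (-(1 / 64))) M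
  have hexp := Real.exp_pos (-(1 / 2) * (n : ℝ) ^ (1 / 2 : ℝ))
  rcases lt_or_ge n N with h | h
  · have h1 : ∑ m ∈ Finset.Icc M ⌊(n : ℝ) / Real.log n ^ 2⌋₊, sparseMeanCubeSum G m ≤
        (⌊(n : ℝ) / Real.log n ^ 2⌋₊ + 1) * (n : ℝ) ^ n := by
      refine (Finset.sum_le_card_nsmul _ _ ((n : ℝ) ^ n) fun m _ => ?_).trans ?_
      · rw [hn]; exact sum_norm_bijMean_cube_le_card_pow (by simp) m
      · rw [nsmul_eq_mul, Nat.card_Icc]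
        gcongr
        exact_mod_cast Nat.sub_le _ _
    have h2 : (⌊(n : ℝ) / Real.log n ^ 2⌋₊ + 1) * (n : ℝ) ^ n =
        g n * Real.exp (-(1 / 2) * (n : ℝ) ^ (1 / 2 : ℝ)) := by
      rw [hg]
      simp only
      rw [mul_assoc _ (Real.exp _), ← Real.exp_add]
      simp
    have h3 : g n ≤ ∑ n ∈ Finset.range N, g n :=
      Finset.single_le_sum (fun n _ => hg0 n) (Finset.mem_range.2 h)
    rw [h2] at h1
    refine h1.trans (le_add_of_nonneg_of_le (mul_nonneg (by linarith) hpow.le) ?_)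
    exact mul_le_mul_of_nonneg_right (by linarith) hexp.le
  · obtain ⟨hq1, hlq, hll, hl⟩ := hN n h
    have hq : ((n : ℝ) ^ (1 / 8 : ℝ)) ^ 8 = n := by
      rw [← Real.rpow_natCast, ← Real.rpow_mul (by positivity)]
      norm_num
    refine (sum_cube_bound_le hq hq1 hlq hl fun m hm => ?_).trans ?_
    · obtain ⟨h1, h2⟩ := Finset.mem_Icc.1 hm
      refine sparseMeanCubeSum_le_of_large hn hq1 hlq hll hl (hM.trans h1) ?_
      exact (Nat.cast_le.2 h2).trans (Nat.floor_le (by positivity))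
    · exact add_le_add (mul_le_mul_of_nonneg_right (by linarith) hpow.le)
        (mul_le_mul_of_nonneg_right (by linarith) hexp.le)

end SecondPart

theorem mainTheorem7 :
    (∃ C : ℝ, 0 < C ∧
      ∀ (G : Type u) [AddCommGroup G] [Fintype G] (n : ℕ), n = Fintype.card G →
      ∀ (δ : ℝ), 0 ≤ δ → δ ≤ 1 / 2 →
      ∀ (m : ℕ), (m : ℝ) ≤ (n : ℝ) / 2 →
        sparseCubeSum G m ≤
          Real.exp (C * ((m : ℝ) ^ (3 / 2 : ℝ) / (n : ℝ) ^ (1 / 2 : ℝ) + (m : ℝ) ^ (1 / 2 : ℝ))) *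
              (1 - δ) ^ ((m : ℝ) / 2) * ((n.factorial : ℝ) / (n : ℝ) ^ n) ^ 3 +
            2 ^ m * (n : ℝ) ^ (δ * (m : ℝ) + 1) * (n.choose m : ℝ) ^ (-(1 / 2) : ℝ) *
              ((n.factorial : ℝ) / (n : ℝ) ^ n) ^ 3) ∧
    (∃ (η : ℝ) (M₀ : ℕ) (K c : ℝ), 0 < η ∧ η < 1 ∧ 0 < K ∧ 0 < c ∧
      ∀ (G : Type u) [AddCommGroup G] [Fintype G] (n : ℕ), n = Fintype.card G → 2 ≤ n →
      ∀ M : ℕ, M₀ ≤ M →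
        ∑ m ∈ Finset.Icc M ⌊(n : ℝ) / Real.log n ^ 2⌋₊, sparseCubeSum G m ≤
          K * (η ^ M * ((n.factorial : ℝ) / (n : ℝ) ^ n) ^ 3) +
            K * (Real.exp (-c * (n : ℝ) ^ (1 / 2 : ℝ)) *
              ((n.factorial : ℝ) / (n : ℝ) ^ n) ^ 3)) := by
  refine ⟨⟨34, by norm_num, fun G _ _ n hn δ hδ hδ2 m hm => sparseCubeSum_le G hn hδ hδ2 hm⟩, ?_⟩
  obtain ⟨K, hK, h⟩ := exists_sum_sparseMeanCubeSum_le.{u}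
  refine ⟨Real.exp (-(1 / 64)), 2 ^ 20, K, 1 / 2, Real.exp_pos _, Real.exp_lt_one_iff.2 (by norm_num),
    hK, by norm_num, fun G _ _ n hn _ M hM => ?_⟩
  classical
  have h1 := mul_le_mul_of_nonneg_right (h G n hn M hM)
    (by positivity : 0 ≤ ((n.factorial : ℝ) / (n : ℝ) ^ n) ^ 3)
  rw [Finset.sum_mul] at h1
  have h2 : ∀ m, sparseCubeSum G m =
      sparseMeanCubeSum G m * ((n.factorial : ℝ) / (n : ℝ) ^ n) ^ 3 := fun m => by
    rw [sparseCubeSum_eq, hn, sparseMeanCubeSum]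
  simp_rw [h2]
  refine h1.trans (le_of_eq ?_)
  ring
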